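/- Let $t_0<t_1$, $a_0\in\mathbb{R}$ and $0<a<b<1$, and let $\alpha:\mathbb{R}\to[a,b]$ be continuously differentiable with bounded derivative. For $r,s\in\mathbb{R}$ write $r^{\langle s\rangle}=\operatorname{sign}(r)|r|^s$ (so $0^{\langle s\rangle}=0$). Let $D[t_0,t_1)$ be the set of functions $f:[t_0,t_1)\to\mathbb{R}$ that are right continuous on $[t_0,t_1)$ and have a finite left limit $f(u_-)=\lim_{t\nearrow u}f(t)$ at every $u\in(t_0,t_1]$ (including $u=t_1$). Let $\Pi\subset(t_0,t_1)\times\mathbb{R}$ be a Poisson point process, on a probability space $(\Omega,\mathcal{F},\mathbb{P})$, with mean measure the plane Lebesgue measure $\mathcal{L}^2$ on $(t_0,t_1)\times\mathbb{R}$; that is, $\Pi$ is a random countable set such that the number of points of $\Pi$ in each Borel set $A\subset(t_0,t_1)\times\mathbb{R}$ is a random variable that is Poisson distributed with mean $\mathcal{L}^2(A)$ (almost surely infinite if $\mathcal{L}^2(A)=\infty$), independently for finitely many pairwise disjoint sets $A$. For $t\in[t_0,t_1)$ let $\mathcal{F}_t$ be the $\sigma$-algebra generated by the numbers of points of $\Pi$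 in the Borel subsets of $(t_0,t]\times\mathbb{R}$. Then there is a process $Z=(Z(t))_{t_0\le t<t_1}$ on this probability space, adapted to $(\mathcal{F}_t)$, with the following properties. 1. $Z$ is a Markov process: for all $t_0\le s\le t<t_1$ and every Borel set $A\subset\mathbb{R}$, almost surely $\mathbb{P}(Z(t)\in A\mid\mathcal{F}_s)=\mathbb{P}(Z(t)\in A\mid Z(s))$. 2. Almost surely, the sample path of $Z$ is in $D[t_0,t_1)$, $Z(t_0)=a_0$, and $$Z(t)=a_0+\sum_{(X,Y)\in\Pi}1_{(t_0,t]}(X)\,Y^{\langle-1/\alpha(Z(X_-))\rangle}\qquad(t_0\le t<t_1),$$ the sum being absolutely convergent. 3. For every $n\in\mathbb{N}$ there is a process $Z_n=(Z_n(t))_{t_0\le t<t_1}$ which, almost surely, has its sample path in $D[t_0,t_1)$ and satisfies $$Z_n(t)=a_0+\sum_{(X,Y)\in\Pi:\,|Y|\le n}1_{(t_0,t]}(X)\,Y^{\langle-1/\alpha(Z_n(X_-))\rangle}\qquad(t_0\le t<t_1).$$ For every such sequence $(Z_n)_{n\in\mathbb{N}}$, almost surely $\sup_{t_0\le t<t_1}|Z_n(t)-Z(t)|\to0$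 as $n\to\infty$. -/

import Mathlib

open MeasureTheory ProbabilityTheory Set Filter Topology

noncomputable section

/-- The signed power `r^⟨s⟩ = sign(r) |r|^s`. -/
def signedPow (r s : ℝ) : ℝ := Real.sign r * |r| ^ s

/-- The number of points of the random set `Pi` in `A`, possibly infinite. -/
def pointCount {Ω E : Type*} (Pi : Ω → Set E) (A : Set E) (ω : Ω) : ℕ∞ := (Pi ω ∩ A).encard

/-- `Pi` is a Poisson point process (a random countable set of points) with mean measure `μ`:
the number of points in each measurable set `A` is a random variable having the Poisson
distribution with mean `μ A` (almost surely infinite when `μ A = ∞`), and the numbers of points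
in finitely many pairwise disjoint measurable sets are independent. -/
structure IsPoissonPointProcess {Ω E : Type*} [MeasurableSpace Ω] [MeasurableSpace E]
    (Pi : Ω → Set E) (μ : Measure E) (P : Measure Ω) : Prop where
  countable : ∀ ω, (Pi ω).Countable
  measurable_count : ∀ A : Set E, MeasurableSet A → Measurable (pointCount Pi A)
  law_count : ∀ A : Set E, MeasurableSet A → μ A ≠ ⊤ →
    P.map (pointCount Pi A) =
      (poissonMeasure (μ A).toNNReal).map (fun k : ℕ => (k : ℕ∞))
  count_eq_top : ∀ A : Set E, MeasurableSet A → μ A = ⊤ → ∀ᵐ ω ∂P, pointCount Pi A ω = ⊤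
  indep_count : ∀ (n : ℕ) (A : Fin n → Set E), (∀ i, MeasurableSet (A i)) →
    Pairwise (fun i j => Disjoint (A i) (A j)) → iIndepFun (fun i => pointCount Pi (A i)) P

/-- The filtration `(ℱ_t)`, `t ∈ [t₀, t₁)`, of a point process in the plane: `ℱ_t` is the
σ-algebra generated by the restriction of the point process to `(t₀, t] × ℝ`, that is, by the
numbers of points in the Borel subsets of `(t₀, t] × ℝ`. -/
def IsPoissonPointProcess.filtration {Ω : Type*} [mΩ : MeasurableSpace Ω]
    {Pi : Ω → Set (ℝ × ℝ)} {μ : Measure (ℝ × ℝ)} {P : Measure Ω}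
    (h : IsPoissonPointProcess Pi μ P) (t₀ t₁ : ℝ) : Filtration (Ico t₀ t₁) mΩ where
  seq t := ⨆ (A : Set (ℝ × ℝ)) (_ : MeasurableSet A) (_ : A ⊆ Ioc t₀ (t : ℝ) ×ˢ univ),
    MeasurableSpace.comap (pointCount Pi A) inferInstance
  mono' := by
    intro s t hst
    refine iSup_mono fun A => iSup_mono fun _ => iSup_mono' fun hA => ⟨?_, le_rfl⟩
    exact hA.trans (prod_mono (Ioc_subset_Ioc_right hst) Subset.rfl)
  le' := by
    intro t
    refine iSup_le fun A => iSup_le fun hA => iSup_le fun _ => ?_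
    exact (h.measurable_count A hA).comap_le

/-- `Z` is a Markov process with respect to the filtration `ℱ`: it is adapted, and for `s ≤ t`
the conditional law of `Z t` given `ℱ s` is its conditional law given `Z s`. -/
def IsMarkovProcess {Ω ι E : Type*} [Preorder ι] [mΩ : MeasurableSpace Ω] [MeasurableSpace E]
    (Z : ι → Ω → E) (ℱ : Filtration ι mΩ) (P : Measure Ω) : Prop :=
  Adapted ℱ Z ∧ ∀ s t : ι, s ≤ t → ∀ A : Set E, MeasurableSet A →
    P⟦Z t ⁻¹' A | ℱ s⟧ =ᵐ[P] P⟦Z t ⁻¹' A | MeasurableSpace.comap (Z s) inferInstance⟧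

/-- The restriction of `f` to `[t₀, t₁)` belongs to `D[t₀, t₁)`: it is right continuous on
`[t₀, t₁)` and has finite left limits at all points of `(t₀, t₁]`, including `t₁`. -/
def IsCadlagOn (t₀ t₁ : ℝ) (f : ℝ → ℝ) : Prop :=
  (∀ u ∈ Ico t₀ t₁, Tendsto f (𝓝[>] u) (𝓝 (f u))) ∧
    ∀ u ∈ Ioc t₀ t₁, ∃ l : ℝ, Tendsto f (𝓝[<] u) (𝓝 l)

/-- For all `t ∈ [t₀, t₁)`,
`f t = a₀ + ∑_{(x,y) ∈ S} 1_{(t₀,t]}(x) y^⟨-1/α(f(x₋))⟩`, with (absolutely) convergent sum. -/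
def SatisfiesJumpEquation (t₀ t₁ a₀ : ℝ) (α : ℝ → ℝ) (S : Set (ℝ × ℝ)) (f : ℝ → ℝ) : Prop :=
  ∀ t ∈ Ico t₀ t₁,
    HasSum (fun p : S => (Ioc t₀ t).indicator (fun _ => (1 : ℝ)) p.1.1 *
      signedPow p.1.2 (-1 / α (Function.leftLim f p.1.1))) (f t - a₀)

end

/-! The argument is pathwise until the Markov property. The jump at a point (x, y) and its Lipschitz
constant in the level are both at most a weight K(x, y), of size |y|^(-1/b) up to a logarithm for
large |y|. As b < 1, this weight is integrable over the part |y| > 1 of the strip, so by Campbell's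
formula K is almost surely summable over the points there; almost surely only finitely many points
have |y| ≤ 1.

For a fixed set of points with K summable, the unknown is the left limit w(p) = Z(x_-) at each point
p. It satisfies w(p) = a₀ plus the sum of F(q, w(q)) over the points q with smaller abscissa. The
abscissas may be dense, so no induction over jumps is possible; instead `setSum_mul_expWeight_le`, a
discrete form of ∫ k exp(2∫k) ≤ exp(2∫k)/2, makes the equation a contraction in a weighted sup norm
(`exists_isJumpSolution`). The same inequality gives Gronwall estimates, from which
`tsum_mul_abs_sub_le` compares the solution with one that ignores some earlier jumps. This one
estimate yields uniqueness, Lipschitz dependence on the initial value, convergence of the Euler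
scheme, and uniform convergence of the truncations |y| ≤ n.

Adaptedness holds because Euler approximations are measurable functions of the counts
(`measurable_setFlow`). For the Markov property, Z(t) is the flow over the points in (s, t] applied
to Z(s) (`setFlow_Ioc`); these points are independent of the past (`indep_countSigma`), and freezing
Z(s) identifies both conditional laws (`condExp_preimage_eq_of_indep`). -/

/-! ### Sums over subsets of an index set -/

/-- The sum of `K` over the set `A`. -/
noncomputable def setSum {ι : Type*} (K : ι → ℝ) (A : Set ι) : ℝ := ∑' q, A.indicator K q

section SetSum

variable {ι : Type*} {K G : ι → ℝ} {A B : Set ι}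

theorem setSum_univ (K : ι → ℝ) : setSum K univ = ∑' q, K q := by simp [setSum]

theorem setSum_nonneg (hK : ∀ q, 0 ≤ K q) (A : Set ι) : 0 ≤ setSum K A :=
  tsum_nonneg fun _ => indicator_nonneg (fun q _ => hK q) _

theorem setSum_mono (hs : Summable K) (hK : ∀ q, 0 ≤ K q) (h : A ⊆ B) :
    setSum K A ≤ setSum K B :=
  (hs.indicator A).tsum_le_tsum (fun q => indicator_le_indicator_of_subset h hK q)
    (hs.indicator B)

theorem setSum_le_tsum (hs : Summable K) (hK : ∀ q, 0 ≤ K q) (A : Set ι) :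
    setSum K A ≤ ∑' q, K q := by
  rw [← setSum_univ]
  exact setSum_mono hs hK (subset_univ A)

theorem setSum_le_setSum (hs : Summable K) (hG : Summable G) (h : ∀ q, K q ≤ G q) (A : Set ι) :
    setSum K A ≤ setSum G A :=
  (hs.indicator A).tsum_le_tsum (fun q => indicator_le_indicator (h q)) (hG.indicator A)

theorem setSum_add (hs : Summable K) (hG : Summable G) (A : Set ι) :
    setSum (fun q => K q + G q) A = setSum K A + setSum G A := by
  simp only [setSum]
  rw [← (hs.indicator A).tsum_add (hG.indicator A)]
  simp only [← indicator_add]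

theorem setSum_sub (hs : Summable K) (hG : Summable G) (A : Set ι) :
    setSum (fun q => K q - G q) A = setSum K A - setSum G A := by
  simp only [setSum]
  rw [← (hs.indicator A).tsum_sub (hG.indicator A)]
  simp only [← indicator_sub]

theorem setSum_const_mul (c : ℝ) (K : ι → ℝ) (A : Set ι) :
    setSum (fun q => c * K q) A = c * setSum K A := by
  simp only [setSum, ← tsum_mul_left]
  congr 1 with q
  by_cases hq : q ∈ A <;> simp [hq]

theorem setSum_insert {a : ι} (hs : Summable K) (ha : a ∉ A) :
    setSum K (insert a A) = K a + setSum K A := by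
  classical
  have h : (insert a A).indicator K
      = fun q => (if q = a then K a else 0) + A.indicator K q := by
    ext q
    by_cases hq : q = a
    · subst hq
      simp [ha]
    · by_cases hA : q ∈ A <;> simp [hq, hA]
  simp only [setSum, h]
  rw [Summable.tsum_add (summable_of_hasFiniteSupport ((finite_singleton a).subset ?_))
    (hs.indicator A), tsum_ite_eq]
  intro q hq
  by_contra h'
  simp_all

theorem abs_setSum_le (hG : Summable G) (h : ∀ q, |K q| ≤ G q) (A : Set ι) :
    |setSum K A| ≤ setSum G A := by
  have hK : Summable K := hG.of_norm_bounded h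
  have := norm_tsum_le_tsum_norm (hK.indicator A).norm
  refine this.trans ((hK.indicator A).norm.tsum_le_tsum (fun q => ?_) (hG.indicator A))
  rw [norm_indicator_eq_indicator_norm]
  exact indicator_le_indicator (h q)

theorem setSum_inter (K : ι → ℝ) (A B : Set ι) :
    setSum (A.indicator K) B = setSum K (A ∩ B) := by
  simp only [setSum, indicator_indicator, inter_comm]

theorem setSum_union (hs : Summable K) (h : Disjoint A B) :
    setSum K (A ∪ B) = setSum K A + setSum K B := by
  simp only [setSum]
  rw [← (hs.indicator A).tsum_add (hs.indicator B), indicator_union_of_disjoint h]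

theorem summable_mul_of_bdd {v : ι → ℝ} (hs : Summable K) (hK : ∀ q, 0 ≤ K q)
    (hv : ∃ C, ∀ q, |v q| ≤ C) : Summable fun q => K q * v q := by
  obtain ⟨C, hC⟩ := hv
  refine (hs.mul_right C).of_norm_bounded fun q => ?_
  rw [Real.norm_eq_abs, abs_mul, abs_of_nonneg (hK q)]
  exact mul_le_mul_of_nonneg_left (hC q) (hK q)

end SetSum

/-! ### A Gronwall inequality for sums over a possibly dense set of times -/

section Gronwall

variable {ι : Type*} (x : ι → ℝ) {K : ι → ℝ}

/-- The weight `exp (2 ∑_{x q < t} K q)`. -/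
noncomputable def expWeight (x K : ι → ℝ) (t : ℝ) : ℝ := Real.exp (2 * setSum K {q | x q < t})

theorem expWeight_pos (x K : ι → ℝ) (t : ℝ) : 0 < expWeight x K t := Real.exp_pos _

theorem one_le_expWeight (hK : ∀ q, 0 ≤ K q) (t : ℝ) : 1 ≤ expWeight x K t :=
  Real.one_le_exp (mul_nonneg two_pos.le (setSum_nonneg hK _))

theorem expWeight_le (hs : Summable K) (hK : ∀ q, 0 ≤ K q) (t : ℝ) :
    expWeight x K t ≤ Real.exp (2 * ∑' q, K q) :=
  Real.exp_le_exp.2 (mul_le_mul_of_nonneg_left (setSum_le_tsum hs hK _) two_pos.le)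

/-- Finitely many points can be added in increasing order of `x`. If b is the weight of everything
counted other than the new point a, the step is exp(2b)/2 + K a exp(2b) = (1 + 2 K a) exp(2b)/2 ≤
exp(2(b + K a))/2. The set in the exponent includes all indices below some point of `s`, since
`expWeight` sees them all. -/
theorem finset_sum_mul_expWeight_le (hs : Summable K) (hK : ∀ q, 0 ≤ K q) (s : Finset ι) :
    ∑ q ∈ s, K q * expWeight x K (x q)
      ≤ Real.exp (2 * setSum K {q | q ∈ s ∨ ∃ r ∈ s, x q < x r}) / 2 := by
  classical
  induction s using Finset.induction_on_max_value x with
  | empty => simp; positivity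
  | insert a s ha hmax ih =>
    set D := {q | q ∈ s ∨ ∃ r ∈ s, x q < x r} with hD
    set D' := {q | q ∈ insert a s ∨ ∃ r ∈ insert a s, x q < x r} with hD'
    rw [Finset.sum_insert ha]
    set b := setSum K (D' \ {a}) with hb
    have h1 : D ⊆ D' \ {a} := by
      rintro q hq
      refine ⟨?_, ?_⟩
      · rcases hq with hq | ⟨r, hr, hqr⟩
        · exact Or.inl (Finset.mem_insert_of_mem hq)
        · exact Or.inr ⟨r, Finset.mem_insert_of_mem hr, hqr⟩
      · rintro rfl
        rcases hq with hq | ⟨r, hr, hqr⟩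
        · exact ha hq
        · exact absurd hqr (not_lt.2 (hmax r hr))
    have h2 : {q | x q < x a} ⊆ D' \ {a} := by
      intro q hq
      refine ⟨Or.inr ⟨a, Finset.mem_insert_self _ _, hq⟩, ?_⟩
      rintro rfl
      exact lt_irrefl (x q) hq
    have h3 : setSum K D' = K a + b := by
      rw [hb, ← setSum_insert hs (by simp)]
      congr 1
      rw [insert_sdiff_self_of_mem]
      exact Or.inl (Finset.mem_insert_self _ _)
    have h4 : Real.exp (2 * setSum K D) ≤ Real.exp (2 * b) :=
      Real.exp_le_exp.2 (by linarith [setSum_mono hs hK h1])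
    have h5 : expWeight x K (x a) ≤ Real.exp (2 * b) :=
      Real.exp_le_exp.2 (by linarith [setSum_mono hs hK h2])
    have h6 : 1 + 2 * K a ≤ Real.exp (2 * K a) := by linarith [Real.add_one_le_exp (2 * K a)]
    rw [h3, mul_add, Real.exp_add]
    have h7 := mul_le_mul_of_nonneg_left h5 (hK a)
    nlinarith [Real.exp_pos (2 * b)]

theorem setSum_mul_expWeight_le (hs : Summable K) (hK : ∀ q, 0 ≤ K q) (t : ℝ) :
    setSum (fun q => K q * expWeight x K (x q)) {q | x q < t} ≤ expWeight x K t / 2 := by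
  classical
  refine Real.tsum_le_of_sum_le (fun q => indicator_nonneg
    (fun q _ => mul_nonneg (hK q) (expWeight_pos _ _ _).le) _) fun s => ?_
  have : ∑ q ∈ s, {q | x q < t}.indicator (fun q => K q * expWeight x K (x q)) q
      = ∑ q ∈ s.filter fun q => x q < t, K q * expWeight x K (x q) := by
    rw [Finset.sum_filter]
    exact Finset.sum_congr rfl fun q _ => by simp [indicator_apply]
  rw [this]
  refine (finset_sum_mul_expWeight_le x hs hK _).trans ?_
  refine div_le_div_of_nonneg_right (Real.exp_le_exp.2 ?_) two_pos.le
  refine mul_le_mul_of_nonneg_left (setSum_mono hs hK ?_) two_pos.le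
  rintro q (hq | ⟨r, hr, hqr⟩)
  · exact (Finset.mem_filter.1 hq).2
  · exact hqr.trans (Finset.mem_filter.1 hr).2

/-- The supremum m of u divided by the weight satisfies m ≤ ε + m/2; boundedness of u makes m
finite, so that m/2 can be absorbed. -/
theorem le_of_le_add_setSum (hs : Summable K) (hK : ∀ q, 0 ≤ K q) {u : ι → ℝ} {ε : ℝ}
    (hε : 0 ≤ ε) (hu : ∀ q, 0 ≤ u q) (hub : ∃ C, ∀ q, u q ≤ C)
    (h : ∀ p, u p ≤ ε + setSum (fun q => K q * u q) {q | x q < x p}) (p : ι) :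
    u p ≤ 2 * ε * Real.exp (2 * ∑' q, K q) := by
  obtain ⟨C, hC⟩ := hub
  have hsum := summable_mul_of_bdd hs hK ⟨C, fun q => (abs_of_nonneg (hu q)).trans_le (hC q)⟩
  set m := ⨆ q, u q / expWeight x K (x q) with hm
  have hbdd : BddAbove (range fun q => u q / expWeight x K (x q)) := by
    refine ⟨C, ?_⟩
    rintro _ ⟨q, rfl⟩
    exact (div_le_self (hu q) (one_le_expWeight x hK _)).trans (hC q)
  have hum : ∀ q, u q ≤ m * expWeight x K (x q) := fun q =>
    (div_le_iff₀ (expWeight_pos _ _ _)).1 (le_ciSup hbdd q)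
  have hWs : Summable fun q => K q * expWeight x K (x q) :=
    summable_mul_of_bdd hs hK ⟨_, fun q => (abs_of_pos (expWeight_pos _ _ _)).trans_le
      (expWeight_le x hs hK _)⟩
  have hm0 : 0 ≤ m := Real.iSup_nonneg fun q => div_nonneg (hu q) (expWeight_pos _ _ _).le
  have key : ∀ p, u p / expWeight x K (x p) ≤ ε + m / 2 := by
    intro p
    rw [div_le_iff₀ (expWeight_pos _ _ _)]
    have h1 : setSum (fun q => K q * u q) {q | x q < x p}
        ≤ m * (expWeight x K (x p) / 2) := by
      refine le_trans ?_ (mul_le_mul_of_nonneg_left (setSum_mul_expWeight_le x hs hK (x p)) hm0)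
      rw [← setSum_const_mul]
      refine setSum_le_setSum hsum (hWs.mul_left m) (fun q => ?_) _
      nlinarith [mul_le_mul_of_nonneg_left (hum q) (hK q)]
    have h2 := h p
    nlinarith [one_le_expWeight x hK (x p)]
  have : Nonempty ι := ⟨p⟩
  have hm2 : m ≤ 2 * ε := by linarith [ciSup_le key]
  calc u p ≤ m * expWeight x K (x p) := hum p
    _ ≤ 2 * ε * Real.exp (2 * ∑' q, K q) :=
      mul_le_mul hm2 (expWeight_le x hs hK _) (expWeight_pos _ _ _).le (by positivity)

/-- The constant in the Gronwall inequality for jump equations. -/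
noncomputable def gronwallConst (K : ι → ℝ) : ℝ :=
  1 + 2 * Real.exp (2 * ∑' q, K q) * ∑' q, K q

theorem gronwallConst_nonneg (hK : ∀ q, 0 ≤ K q) : 0 ≤ gronwallConst K := by
  have : 0 ≤ ∑' q, K q := tsum_nonneg hK
  unfold gronwallConst
  positivity

/-- The error η may vary with the point, and only its K-weighted total enters the bound. This lets
dominated convergence replace uniform smallness of η. The partial sums of K v satisfy the preceding
inequality with the constant ε = ∑ K η. -/
theorem tsum_mul_le_of_le_add_setSum (hs : Summable K) (hK : ∀ q, 0 ≤ K q) {v η : ι → ℝ}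
    (hv : ∀ q, 0 ≤ v q) (hvb : ∃ C, ∀ q, v q ≤ C) (hη : ∀ q, 0 ≤ η q) (hηb : ∃ C, ∀ q, η q ≤ C)
    (h : ∀ p, v p ≤ η p + setSum (fun q => K q * v q) {q | x q < x p}) :
    ∑' q, K q * v q ≤ gronwallConst K * ∑' q, K q * η q := by
  obtain ⟨C, hC⟩ := hvb
  obtain ⟨C', hC'⟩ := hηb
  have hvs := summable_mul_of_bdd hs hK ⟨C, fun q => (abs_of_nonneg (hv q)).trans_le (hC q)⟩
  have hηs := summable_mul_of_bdd hs hK ⟨C', fun q => (abs_of_nonneg (hη q)).trans_le (hC' q)⟩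
  have hKv0 : ∀ q, 0 ≤ K q * v q := fun q => mul_nonneg (hK q) (hv q)
  have hKη0 : ∀ q, 0 ≤ K q * η q := fun q => mul_nonneg (hK q) (hη q)
  set U : ι → ℝ := fun p => setSum (fun q => K q * v q) {q | x q < x p} with hU
  have hU0 : ∀ p, 0 ≤ U p := fun p => setSum_nonneg hKv0 _
  have hUC : ∀ p, U p ≤ ∑' q, K q * v q := fun p => setSum_le_tsum hvs hKv0 _
  have hUs := summable_mul_of_bdd hs hK ⟨_, fun q => (abs_of_nonneg (hU0 q)).trans_le (hUC q)⟩
  have hle : ∀ q, K q * v q ≤ K q * η q + K q * U q := fun q => by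
    rw [← mul_add]
    exact mul_le_mul_of_nonneg_left (h q) (hK q)
  set ε := ∑' q, K q * η q with hε
  have hε0 : 0 ≤ ε := tsum_nonneg hKη0
  have hUle := le_of_le_add_setSum x hs hK hε0 hU0 ⟨_, hUC⟩ fun p => by
    calc U p ≤ setSum (fun q => K q * η q + K q * U q) {q | x q < x p} :=
          setSum_le_setSum hvs (hηs.add hUs) hle _
      _ = _ := setSum_add hηs hUs _
      _ ≤ _ := add_le_add_left (setSum_le_tsum hηs hKη0 _) _
  calc ∑' q, K q * v q ≤ ∑' q, (K q * η q + K q * (2 * ε * Real.exp (2 * ∑' q, K q))) := by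
        refine hvs.tsum_le_tsum (fun q => (hle q).trans ?_) (hηs.add (hs.mul_right _))
        exact add_le_add_right (mul_le_mul_of_nonneg_left (hUle q) (hK q)) _
    _ = gronwallConst K * ε := by
        rw [hηs.tsum_add (hs.mul_right _), tsum_mul_right, gronwallConst]
        ring

end Gronwall

/-! ### Existence, uniqueness and stability for jump equations -/

/-- The coefficients `F` of a jump equation are dominated by the summable weights `K`, together
with their Lipschitz constants. -/
structure IsDominated {ι : Type*} (F : ι → ℝ → ℝ) (K : ι → ℝ) : Prop where
  nonneg : ∀ q, 0 ≤ K q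
  summable : Summable K
  bound : ∀ q z, |F q z| ≤ K q
  lipschitz : ∀ q z z', |F q z - F q z'| ≤ K q * |z - z'|

/-- `w` solves the equation `w p = z + ∑_{q ∈ A p} F q (w q)`. -/
def IsJumpSolution {ι : Type*} (A : ι → Set ι) (F : ι → ℝ → ℝ) (z : ℝ) (w : ι → ℝ) : Prop :=
  ∀ p, w p = z + setSum (fun q => F q (w q)) (A p)

namespace IsDominated

variable {ι : Type*} {F : ι → ℝ → ℝ} {K : ι → ℝ} (hF : IsDominated F K)

include hF

theorem summable_apply (w : ι → ℝ) : Summable fun q => F q (w q) :=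
  hF.summable.of_norm_bounded fun q => hF.bound q (w q)

theorem abs_setSum_sub_le {w w' : ι → ℝ} (h : ∃ C, ∀ q, |w q - w' q| ≤ C) (A : Set ι) :
    |setSum (fun q => F q (w q)) A - setSum (fun q => F q (w' q)) A|
      ≤ setSum (fun q => K q * |w q - w' q|) A := by
  rw [← setSum_sub (hF.summable_apply w) (hF.summable_apply w')]
  exact abs_setSum_le (summable_mul_of_bdd hF.summable hF.nonneg (by simpa using h))
    (fun q => hF.lipschitz q _ _) A

theorem abs_sub_le_of_isJumpSolution {A : ι → Set ι} {z : ℝ} {w : ι → ℝ}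
    (hw : IsJumpSolution A F z w) (p : ι) : |w p - z| ≤ ∑' q, K q := by
  rw [hw p, add_sub_cancel_left]
  exact (abs_setSum_le hF.summable (fun q => hF.bound q _) _).trans
    (setSum_le_tsum hF.summable hF.nonneg _)

theorem abs_sub_le_of_isJumpSolution₂ {A A' : ι → Set ι} {z z' : ℝ} {w w' : ι → ℝ}
    (hw : IsJumpSolution A F z w) (hw' : IsJumpSolution A' F z' w') (p : ι) :
    |w p - w' p| ≤ |z - z'| + 2 * ∑' q, K q := by
  have h1 := hF.abs_sub_le_of_isJumpSolution hw p
  have h2 := hF.abs_sub_le_of_isJumpSolution hw' p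
  rw [abs_le] at h1 h2 ⊢
  constructor <;> linarith [le_abs_self (z - z'), neg_abs_le (z - z')]

variable (x : ι → ℝ)

/-- Comparison of the solution of a jump equation with the solution of an equation in which some
of the earlier jumps are ignored. -/
theorem tsum_mul_abs_sub_le {A : ι → Set ι} (hA : ∀ p, A p ⊆ {q | x q < x p}) {z z' : ℝ}
    {w w' : ι → ℝ} (hw : IsJumpSolution (fun p => {q | x q < x p}) F z w)
    (hw' : IsJumpSolution A F z' w') :
    ∑' q, K q * |w q - w' q| ≤ gronwallConst K *
      ∑' p, K p * (|z - z'| + setSum K ({q | x q < x p} \ A p)) := by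
  have hb : ∃ C, ∀ q, |w q - w' q| ≤ C := ⟨_, hF.abs_sub_le_of_isJumpSolution₂ hw hw'⟩
  have hs := summable_mul_of_bdd hF.summable hF.nonneg (v := fun q => |w q - w' q|)
    (by simpa using hb)
  refine tsum_mul_le_of_le_add_setSum x hF.summable hF.nonneg (fun _ => abs_nonneg _) hb
    (fun p => add_nonneg (abs_nonneg _) (setSum_nonneg hF.nonneg _))
    ⟨_, fun p => add_le_add_right (setSum_le_tsum hF.summable hF.nonneg _) _⟩ fun p => ?_
  have h1 : setSum (fun q => F q (w q)) {q | x q < x p}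
      = setSum (fun q => F q (w q)) (A p)
        + setSum (fun q => F q (w q)) ({q | x q < x p} \ A p) := by
    rw [← setSum_union (hF.summable_apply w) disjoint_sdiff_right, union_sdiff_cancel (hA p)]
  have h2 := hF.abs_setSum_sub_le hb (A p)
  have h3 := setSum_mono hs (fun q => mul_nonneg (hF.nonneg q) (abs_nonneg _)) (hA p)
  have h4 := abs_setSum_le hF.summable (fun q => hF.bound q (w q)) ({q | x q < x p} \ A p)
  -- Initial error, ignored jumps (bounded by their size), and common jumps (bounded by the
  -- Lipschitz constants).
  have h5 : w p - w' p = (z - z') + setSum (fun q => F q (w q)) ({q | x q < x p} \ A p)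
      + (setSum (fun q => F q (w q)) (A p) - setSum (fun q => F q (w' q)) (A p)) := by
    rw [hw p, hw' p, h1]
    ring
  rw [h5]
  refine (abs_add_le _ _).trans ?_
  exact add_le_add ((abs_add_le _ _).trans (add_le_add_right h4 _)) (h2.trans h3)

theorem eq_of_isJumpSolution {z : ℝ} {w w' : ι → ℝ}
    (hw : IsJumpSolution (fun p => {q | x q < x p}) F z w)
    (hw' : IsJumpSolution (fun p => {q | x q < x p}) F z w') : w = w' := by
  have h := hF.tsum_mul_abs_sub_le x (fun p => Subset.rfl) hw hw'
  have h0 : ∀ p, K p * (|z - z| + setSum K ({q | x q < x p} \ {q | x q < x p})) = 0 := by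
    intro p
    simp [setSum]
  simp only [h0, tsum_zero, mul_zero] at h
  have hb : ∃ C, ∀ q, |w q - w' q| ≤ C := ⟨_, hF.abs_sub_le_of_isJumpSolution₂ hw hw'⟩
  have hs := summable_mul_of_bdd hF.summable hF.nonneg (v := fun q => |w q - w' q|)
    (by simpa using hb)
  ext p
  -- A vanishing weighted sum says nothing where K p = 0; substituting it back into the equation
  -- gives equality at every p.
  have h2 := hF.abs_setSum_sub_le hb {q | x q < x p}
  have h3 := setSum_le_tsum hs (fun q => mul_nonneg (hF.nonneg q) (abs_nonneg _))
    {q | x q < x p}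
  have h4 := abs_nonpos_iff.1 (h2.trans (h3.trans h))
  rw [hw p, hw' p]
  linarith

/-- Banach's fixed point theorem for w/W, where the weight W makes the Lipschitz constant 1/2
whatever the size of ∑ K. -/
theorem exists_isJumpSolution (z : ℝ) :
    ∃ w, IsJumpSolution (fun p => {q | x q < x p}) F z w := by
  -- With the discrete topology the complete space of bounded continuous functions contains all
  -- bounded functions.
  let _ : TopologicalSpace ι := ⊥
  have : DiscreteTopology ι := ⟨rfl⟩
  set W : ι → ℝ := fun p => expWeight x K (x p) with hW
  have hW1 : ∀ p, 1 ≤ W p := fun p => one_le_expWeight x hF.nonneg _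
  have hWC : ∀ p, W p ≤ Real.exp (2 * ∑' q, K q) := fun p =>
    expWeight_le x hF.summable hF.nonneg _
  have hWs : Summable fun q => K q * W q :=
    summable_mul_of_bdd hF.summable hF.nonneg ⟨_, fun q =>
      (abs_of_nonneg (zero_le_one.trans (hW1 q))).trans_le (hWC q)⟩
  let T : BoundedContinuousFunction ι ℝ → BoundedContinuousFunction ι ℝ := fun v =>
    BoundedContinuousFunction.ofNormedAddCommGroupDiscrete
      (fun p => (z + setSum (fun q => F q (W q * v q)) {q | x q < x p}) / W p)
      (|z| + ∑' q, K q) fun p => by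
        rw [norm_div, Real.norm_of_nonneg (zero_le_one.trans (hW1 p))]
        refine (div_le_self (norm_nonneg _) (hW1 p)).trans ((abs_add_le _ _).trans ?_)
        exact add_le_add_right ((abs_setSum_le hF.summable (fun q => hF.bound q _) _).trans
          (setSum_le_tsum hF.summable hF.nonneg _)) _
  have hT : ContractingWith (1 / 2) T := by
    refine ⟨by norm_num, LipschitzWith.of_dist_le_mul fun v v' => ?_⟩
    refine (BoundedContinuousFunction.dist_le (by positivity)).2 fun p => ?_
    have hW0 : 0 < W p := zero_lt_one.trans_le (hW1 p)
    have hvv : ∀ q, |W q * v q - W q * v' q| ≤ W q * dist v v' := fun q => by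
      rw [← mul_sub, abs_mul, abs_of_nonneg (zero_le_one.trans (hW1 q))]
      exact mul_le_mul_of_nonneg_left (BoundedContinuousFunction.dist_coe_le_dist (f := v) q)
        (zero_le_one.trans (hW1 q))
    have hb : ∃ C, ∀ q, |W q * v q - W q * v' q| ≤ C := ⟨_, fun q => (hvv q).trans
      (mul_le_mul_of_nonneg_right (hWC q) dist_nonneg)⟩
    have h1 := hF.abs_setSum_sub_le hb {q | x q < x p}
    have h2 : setSum (fun q => K q * |W q * v q - W q * v' q|) {q | x q < x p}
        ≤ dist v v' * (W p / 2) := by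
      refine le_trans ?_ (mul_le_mul_of_nonneg_left
        (setSum_mul_expWeight_le x hF.summable hF.nonneg (x p)) dist_nonneg)
      rw [← setSum_const_mul]
      refine setSum_le_setSum (summable_mul_of_bdd hF.summable hF.nonneg (by simpa using hb))
        (hWs.mul_left _) (fun q => ?_) _
      have := mul_le_mul_of_nonneg_left (hvv q) (hF.nonneg q)
      simp only [hW] at this ⊢
      linarith
    change |_ / W p - _ / W p| ≤ _
    rw [← sub_div, abs_div, abs_of_pos hW0, div_le_iff₀ hW0, add_sub_add_left_eq_sub]
    refine (h1.trans h2).trans_eq ?_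
    simp
    ring
  refine ⟨fun p => W p * hT.fixedPoint T p, fun p => ?_⟩
  have hfix : T (hT.fixedPoint T) p = hT.fixedPoint T p := by rw [hT.fixedPoint_isFixedPt]
  change (_ / W p) = _ at hfix
  rw [div_eq_iff (zero_lt_one.trans_le (hW1 p)).ne'] at hfix
  beta_reduce
  rw [mul_comm, ← hfix]

end IsDominated

/-! ### The flow of a jump equation and its Lipschitz continuity -/

/-- The value after all jumps of the solution of the jump equation with initial value `z`. -/
noncomputable def jumpFlow {ι : Type*} (x : ι → ℝ) (F : ι → ℝ → ℝ) (z : ℝ) : ℝ :=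
  open Classical in
  if h : ∃ w, IsJumpSolution (fun p => {q | x q < x p}) F z w then
    z + ∑' q, F q (h.choose q) else z

namespace IsDominated

variable {ι : Type*} {F : ι → ℝ → ℝ} {K : ι → ℝ} (hF : IsDominated F K) (x : ι → ℝ)

include hF

theorem jumpFlow_eq {z : ℝ} {w : ι → ℝ}
    (hw : IsJumpSolution (fun p => {q | x q < x p}) F z w) :
    jumpFlow x F z = z + ∑' q, F q (w q) := by
  have h : ∃ w, IsJumpSolution (fun p => {q | x q < x p}) F z w := ⟨w, hw⟩
  rw [jumpFlow, dif_pos h, hF.eq_of_isJumpSolution x h.choose_spec hw]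

theorem abs_tsum_sub_le {w w' : ι → ℝ} (h : ∃ C, ∀ q, |w q - w' q| ≤ C) :
    |∑' q, F q (w q) - ∑' q, F q (w' q)| ≤ ∑' q, K q * |w q - w' q| := by
  simpa only [setSum_univ] using hF.abs_setSum_sub_le h univ

theorem abs_jumpFlow_sub_le (z z' : ℝ) :
    |jumpFlow x F z - jumpFlow x F z'| ≤ (1 + gronwallConst K * ∑' q, K q) * |z - z'| := by
  obtain ⟨w, hw⟩ := hF.exists_isJumpSolution x z
  obtain ⟨w', hw'⟩ := hF.exists_isJumpSolution x z'
  rw [hF.jumpFlow_eq x hw, hF.jumpFlow_eq x hw']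
  have h1 := hF.tsum_mul_abs_sub_le x (fun p => Subset.rfl) hw hw'
  have h2 := hF.abs_tsum_sub_le ⟨_, hF.abs_sub_le_of_isJumpSolution₂ hw hw'⟩
  simp only [sdiff_self, setSum, indicator_empty, tsum_zero, add_zero,
    tsum_mul_right] at h1
  rw [add_sub_add_comm]
  refine (abs_add_le _ _).trans ?_
  linarith

/-- Continuity in the initial value later turns measurability in ω for each fixed z into joint
measurability, as freezing requires. -/
theorem continuous_jumpFlow : Continuous (jumpFlow x F) :=
  (LipschitzWith.of_dist_le' (K := 1 + gronwallConst K * ∑' q, K q) fun z z' =>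
    hF.abs_jumpFlow_sub_le x z z').continuous

end IsDominated

/-! ### Convergence of the Euler scheme -/

/-- The Euler scheme: the jumps in the cell `c ⁻¹' {k}` are all computed from the value reached
before the `k`-th step. -/
noncomputable def eulerScheme {ι : Type*} (c : ι → ℕ) (F : ι → ℝ → ℝ) (z : ℝ) : ℕ → ℝ
  | 0 => z
  | k + 1 => eulerScheme c F z k + setSum (fun q => F q (eulerScheme c F z k)) {q | c q = k}

namespace IsDominated

variable {ι : Type*} {F : ι → ℝ → ℝ} {K : ι → ℝ} (hF : IsDominated F K) (x : ι → ℝ)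

include hF

/-- In this form the scheme is itself a jump equation, in which earlier jumps of the same cell are
ignored; the comparison estimate therefore applies to it. -/
theorem eulerScheme_eq (c : ι → ℕ) (z : ℝ) (k : ℕ) :
    eulerScheme c F z k = z + setSum (fun q => F q (eulerScheme c F z (c q))) {q | c q < k} := by
  induction k with
  | zero => simp [eulerScheme, setSum]
  | succ k ih =>
    have h : {q | c q < k + 1} = {q | c q < k} ∪ {q | c q = k} := by
      ext q
      simp only [mem_ofPred_eq, mem_union]
      omega
    have hd : Disjoint {q | c q < k} {q | c q = k} :=
      Set.disjoint_left.2 fun q (h1 : c q < k) (h2 : c q = k) => by omega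
    rw [h, setSum_union (hF.summable_apply _) hd, ← add_assoc, ← ih, eulerScheme]
    congr 1
    refine tsum_congr fun q => ?_
    by_cases hq : c q = k
    · simp [hq]
    · simp [hq]

theorem tendsto_eulerScheme {c : ℕ → ι → ℕ} {N : ℕ → ℕ} (z : ℝ)
    (hc : ∀ n p q, c n q < c n p → x q < x p)
    (hN : ∀ n q, K q ≠ 0 → c n q < N n)
    (hlim : ∀ p q, K p ≠ 0 → K q ≠ 0 → x q < x p → ∀ᶠ n in atTop, c n q < c n p) :
    Tendsto (fun n => eulerScheme (c n) F z (N n)) atTop (𝓝 (jumpFlow x F z)) := by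
  obtain ⟨w, hw⟩ := hF.exists_isJumpSolution x z
  rw [hF.jumpFlow_eq x hw]
  set e : ℕ → ι → ℝ := fun n q => eulerScheme (c n) F z (c n q) with he
  have hesol : ∀ n, IsJumpSolution (fun p => {q | c n q < c n p}) F z (e n) := fun n p =>
    hF.eulerScheme_eq (c n) z (c n p)
  have hend : ∀ n, eulerScheme (c n) F z (N n) = z + ∑' q, F q (e n q) := fun n => by
    rw [hF.eulerScheme_eq, setSum]
    congr 2 with q
    by_cases hq : c n q < N n
    · simp [hq, he]
    · have h0 : K q = 0 := by_contra fun h => hq (hN n q h)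
      have := hF.bound q (e n q)
      rw [h0] at this
      simp [hq, abs_nonpos_iff.1 this]
  -- Dominated convergence twice: for each p the weight of the earlier points not yet separated from
  -- p vanishes, and then so does the weighted sum over p.
  have hη : Tendsto (fun n => ∑' p, K p * (|z - z| +
      setSum K ({q | x q < x p} \ {q | c n q < c n p}))) atTop (𝓝 (∑' _ : ι, 0)) := by
    refine tendsto_tsum_of_dominated_convergence
      (bound := fun p => K p * ∑' q, K q) (hF.summable.mul_right _) (fun p => ?_)
      (Eventually.of_forall fun n p => ?_)
    · by_cases hp : K p = 0
      · simp [hp]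
      rw [← mul_zero (K p)]
      refine Tendsto.const_mul _ ?_
      simp only [sub_self, abs_zero, zero_add, setSum]
      rw [← tsum_zero (α := ℝ) (β := ι)]
      refine tendsto_tsum_of_dominated_convergence hF.summable (fun q => ?_)
        (Eventually.of_forall fun n q => ?_)
      · by_cases hq : K q = 0
        · simp [indicator_apply, hq]
        by_cases hqp : x q < x p
        · refine tendsto_const_nhds.congr' ?_
          filter_upwards [hlim p q hp hq hqp] with n hn
          simp [hn]
        · simp [hqp]
      · rw [Real.norm_of_nonneg (indicator_nonneg (fun q _ => hF.nonneg q) q)]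
        exact indicator_le_self' (fun _ _ => hF.nonneg q) q
    · simp only [sub_self, abs_zero, zero_add]
      rw [Real.norm_of_nonneg (mul_nonneg (hF.nonneg p) (setSum_nonneg hF.nonneg _))]
      exact mul_le_mul_of_nonneg_left (setSum_le_tsum hF.summable hF.nonneg _) (hF.nonneg p)
  rw [tsum_zero] at hη
  rw [tendsto_iff_dist_tendsto_zero]
  replace hη := hη.const_mul (gronwallConst K)
  rw [mul_zero] at hη
  refine squeeze_zero (fun _ => dist_nonneg) (fun n => ?_) hη
  rw [hend, dist_comm, Real.dist_eq, add_sub_add_left_eq_sub]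
  exact (hF.abs_tsum_sub_le ⟨_, hF.abs_sub_le_of_isJumpSolution₂ hw (hesol n)⟩).trans
    (hF.tsum_mul_abs_sub_le x (A := fun p => {q | c n q < c n p}) (fun p q hq => hc n p q hq)
      hw (hesol n))

end IsDominated

/-! ### Flows driven by a set of points: restarting and truncation -/

/-- The nonnegative weights `K` dominate the coefficients `F` and their Lipschitz constants. -/
structure IsMajorized {ι : Type*} (F : ι → ℝ → ℝ) (K : ι → ℝ) : Prop where
  nonneg : ∀ q, 0 ≤ K q
  bound : ∀ q z, |F q z| ≤ K q
  lipschitz : ∀ q z z', |F q z - F q z'| ≤ K q * |z - z'|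

/-- The coefficients `F`, restricted to the points of `S`. -/
noncomputable def cutoff {ι : Type*} (S : Set ι) (F : ι → ℝ → ℝ) (q : ι) (z : ℝ) : ℝ :=
  S.indicator (fun q => F q z) q

theorem IsMajorized.isDominated {ι : Type*} {F : ι → ℝ → ℝ} {K : ι → ℝ} (h : IsMajorized F K)
    {S : Set ι} (hS : Summable (S.indicator K)) :
    IsDominated (cutoff S F) (S.indicator K) where
  nonneg q := indicator_nonneg (fun q _ => h.nonneg q) q
  summable := hS
  bound q z := by
    by_cases hq : q ∈ S
    · simpa [cutoff, hq] using h.bound q z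
    · simp [cutoff, hq]
  lipschitz q z z' := by
    by_cases hq : q ∈ S
    · simpa [cutoff, hq] using h.lipschitz q z z'
    · simp [cutoff, hq]

theorem Summable.indicator_subset {ι : Type*} {K : ι → ℝ} {S T : Set ι}
    (hS : Summable (S.indicator K)) (h : T ⊆ S) : Summable (T.indicator K) := by
  rw [← inter_eq_self_of_subset_left h, ← indicator_indicator]
  exact hS.indicator T

section RealSums

variable {ι : Type*} {x c : ι → ℝ}

theorem tendsto_setSum_of_eventually {l : Filter ℝ} {A : ℝ → Set ι} {B : Set ι}
    (hc : Summable c) (h : ∀ q, ∀ᶠ t in l, (q ∈ A t ↔ q ∈ B)) :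
    Tendsto (fun t => setSum c (A t)) l (𝓝 (setSum c B)) := by
  refine tendsto_tsum_of_dominated_convergence hc.norm (fun q => ?_)
    (Eventually.of_forall fun t q => norm_indicator_le_norm_self _ _)
  refine tendsto_const_nhds.congr' ?_
  filter_upwards [h q] with t ht
  by_cases hq : q ∈ B
  · rw [indicator_of_mem hq, indicator_of_mem (ht.2 hq)]
  · rw [indicator_of_notMem hq, indicator_of_notMem fun h => hq (ht.1 h)]

theorem tendsto_setSum_le_nhdsGT (hc : Summable c) (u : ℝ) :
    Tendsto (fun t => setSum c {q | x q ≤ t}) (𝓝[>] u) (𝓝 (setSum c {q | x q ≤ u})) := by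
  refine tendsto_setSum_of_eventually hc fun q => ?_
  rcases le_or_gt (x q) u with h | h
  · filter_upwards [self_mem_nhdsWithin] with t (ht : u < t)
    exact ⟨fun _ => h, fun _ => h.trans ht.le⟩
  · filter_upwards [Ioo_mem_nhdsGT h] with t ht
    exact ⟨fun h' => absurd h' (not_le.2 ht.2), fun h' => absurd h' (not_le.2 h)⟩

theorem tendsto_setSum_le_nhdsLT (hc : Summable c) (u : ℝ) :
    Tendsto (fun t => setSum c {q | x q ≤ t}) (𝓝[<] u) (𝓝 (setSum c {q | x q < u})) := by
  refine tendsto_setSum_of_eventually hc fun q => ?_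
  rcases lt_or_ge (x q) u with h | h
  · filter_upwards [Ioo_mem_nhdsLT h] with t ht
    exact ⟨fun _ => h, fun _ => ht.1.le⟩
  · filter_upwards [self_mem_nhdsWithin] with t (ht : t < u)
    exact ⟨fun h' => absurd h' (not_le.2 (ht.trans_le h)), fun h' => absurd h' (not_lt.2 h)⟩

end RealSums

/-- The value after all jumps of the solution of the jump equation driven by the points of `S`;
if the jumps in `S` are not summable, the initial value. -/
noncomputable def setFlow {ι : Type*} (x : ι → ℝ) (F : ι → ℝ → ℝ) (K : ι → ℝ) (S : Set ι)
    (z : ℝ) : ℝ :=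
  open Classical in if Summable (S.indicator K) then jumpFlow x (cutoff S F) z else z

namespace IsMajorized

variable {ι : Type*} {x : ι → ℝ} {F : ι → ℝ → ℝ} {K : ι → ℝ} (hF : IsMajorized F K) {S : Set ι}

include hF

/-- Without summability the flow is the identity by default, so continuity needs no exceptional set.
-/
theorem continuous_setFlow (S : Set ι) : Continuous (setFlow x F K S) := by
  by_cases hS : Summable (S.indicator K)
  · have : setFlow x F K S = jumpFlow x (cutoff S F) := by
      ext z
      simp [setFlow, hS]
    rw [this]
    exact (hF.isDominated hS).continuous_jumpFlow x
  · have : setFlow x F K S = id := by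
      ext z
      simp [setFlow, hS]
    rw [this]
    exact continuous_id

/-- It is enough that w solves the equation at the points of T: elsewhere it can be redefined
freely, because the cutoff removes those jumps. This allows one w to serve for every time window. -/
theorem setFlow_eq_of_subset (hS : Summable (S.indicator K)) {T : Set ι} (hT : T ⊆ S)
    {w : ι → ℝ} {z : ℝ}
    (hw : ∀ p ∈ T, w p = z + setSum (fun q => cutoff S F q (w q)) (T ∩ {q | x q < x p})) :
    setFlow x F K T z = z + setSum (fun q => cutoff S F q (w q)) T := by
  have hTs := hS.indicator_subset hT
  set w' : ι → ℝ := fun p => z + setSum (fun q => cutoff S F q (w q)) (T ∩ {q | x q < x p})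
    with hw'
  have hcut : (fun q => cutoff T F q (w' q)) = T.indicator fun q => cutoff S F q (w q) := by
    ext q
    by_cases hq : q ∈ T
    · simp only [cutoff, indicator_of_mem hq, indicator_of_mem (hT hq)]
      rw [hw q hq]
    · simp [cutoff, hq]
  have hsol : IsJumpSolution (fun p => {q | x q < x p}) (cutoff T F) z w' := by
    intro p
    rw [hcut, setSum_inter]
  rw [setFlow, if_pos hTs, (hF.isDominated hTs).jumpFlow_eq x hsol, hcut, setSum]

variable (hS : Summable (S.indicator K)) {z : ℝ} {w : ι → ℝ}
  (hw : IsJumpSolution (fun p => {q | x q < x p}) (cutoff S F) z w)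

include hS hw

theorem setFlow_eq_setSum (t : ℝ) :
    setFlow x F K (S ∩ {q | x q ≤ t}) z
      = z + setSum (fun q => cutoff S F q (w q)) {q | x q ≤ t} := by
  have hind : ∀ A : Set ι, setSum (fun q => cutoff S F q (w q)) (S ∩ A)
      = setSum (fun q => cutoff S F q (w q)) A := by
    intro A
    rw [← setSum_inter]
    congr 1
    ext q
    by_cases hq : q ∈ S <;> simp [cutoff, hq]
  rw [hF.setFlow_eq_of_subset hS inter_subset_left (w := w), hind]
  intro p hp
  rw [hw p, inter_assoc, hind]
  congr 2
  ext q
  exact ⟨fun h => ⟨(le_of_lt h : x q ≤ x p).trans hp.2, h⟩, fun h => h.2⟩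

/-- On the window (s, t] the same w solves the equation started from the value reached at s. -/
theorem setFlow_restart {s t : ℝ} (hst : s ≤ t) :
    setFlow x F K (S ∩ {q | x q ≤ t}) z
      = setFlow x F K (S ∩ {q | x q ∈ Ioc s t}) (setFlow x F K (S ∩ {q | x q ≤ s}) z) := by
  have hcs := (hF.isDominated hS).summable_apply w
  have hind : ∀ A : Set ι, setSum (fun q => cutoff S F q (w q)) (S ∩ A)
      = setSum (fun q => cutoff S F q (w q)) A := by
    intro A
    rw [← setSum_inter]
    congr 1
    ext q
    by_cases hq : q ∈ S <;> simp [cutoff, hq]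
  rw [hF.setFlow_eq_setSum hS hw t, hF.setFlow_eq_setSum hS hw s,
    hF.setFlow_eq_of_subset hS inter_subset_left (w := w), hind, add_assoc,
    ← setSum_union hcs]
  · congr 2
    ext q
    exact ⟨fun h => (le_or_gt (x q) s).imp id fun h' => ⟨h', h⟩,
      fun h => h.elim (fun h => le_trans h hst) fun h => h.2⟩
  · exact Set.disjoint_left.2 fun q h h' => not_lt.2 h h'.1
  · intro p hp
    rw [hw p, inter_assoc, hind, add_assoc, ← setSum_union hcs]
    · congr 2
      ext q
      refine ⟨fun h => (le_or_gt (x q) s).imp id fun h' => ⟨⟨h', (le_of_lt h : x q ≤ x p).trans hp.2.2⟩, h⟩,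
        fun h => h.elim (fun h => lt_of_le_of_lt h hp.2.1) fun h => h.2⟩
    · exact Set.disjoint_left.2 fun q h h' => not_lt.2 h h'.1.1

/-- Solutions driven by more and more of the points of `S` converge uniformly. -/
theorem exists_tendsto_zero_abs_setSum_sub_le {B : ℕ → Set ι}
    (hB : ∀ q, ∀ᶠ n in atTop, q ∈ B n) {w' : ℕ → ι → ℝ}
    (hw' : ∀ n, IsJumpSolution (fun p => {q | x q < x p}) (cutoff (S ∩ B n) F) z (w' n)) :
    ∃ δ : ℕ → ℝ, Tendsto δ atTop (𝓝 0) ∧ ∀ n t,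
      |setSum (fun q => cutoff (S ∩ B n) F q (w' n q)) {q | x q ≤ t}
        - setSum (fun q => cutoff S F q (w q)) {q | x q ≤ t}| ≤ δ n := by
  have hD := hF.isDominated hS
  have hlim : Tendsto (fun n => setSum (S.indicator K) (B n)ᶜ) atTop (𝓝 0) := by
    rw [← tsum_zero (α := ℝ) (β := ι)]
    refine tendsto_tsum_of_dominated_convergence hS (fun q => ?_)
      (Eventually.of_forall fun n q => ?_)
    · refine tendsto_const_nhds.congr' ?_
      filter_upwards [hB q] with n hn
      simp [hn]
    · rw [Real.norm_of_nonneg (indicator_nonneg (fun q _ => hD.nonneg q) q)]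
      exact indicator_le_self' (fun _ _ => hD.nonneg q) q
  have hcut : ∀ n A, setSum (fun q => cutoff (S ∩ B n) F q (w' n q)) A
      = setSum (fun q => cutoff S F q (w' n q)) (A ∩ B n) := by
    intro n A
    rw [inter_comm A, ← setSum_inter]
    congr 1
    ext q
    by_cases hq : q ∈ S <;> by_cases hq' : q ∈ B n <;> simp [cutoff, hq, hq']
  -- Truncating the set of points amounts to ignoring the earlier jumps outside `B n`, which is the
  -- setting of the comparison estimate.
  have hw'' : ∀ n, IsJumpSolution (fun p => {q | x q < x p} ∩ B n) (cutoff S F) z (w' n) :=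
    fun n p => by rw [← hcut, ← hw' n p]
  refine ⟨fun n => gronwallConst (S.indicator K) *
    ((∑' p, S.indicator K p) * setSum (S.indicator K) (B n)ᶜ)
      + setSum (S.indicator K) (B n)ᶜ, ?_, fun n t => ?_⟩
  · simpa using ((hlim.const_mul _).const_mul _).add hlim
  have hb : ∃ C, ∀ q, |w q - w' n q| ≤ C :=
    ⟨_, hD.abs_sub_le_of_isJumpSolution₂ hw (hw'' n)⟩
  have hs := summable_mul_of_bdd hS hD.nonneg (v := fun q => |w q - w' n q|) (by simpa using hb)
  have h0 : ∀ q, 0 ≤ S.indicator K q * |w q - w' n q| :=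
    fun q => mul_nonneg (hD.nonneg q) (abs_nonneg _)
  have h1 := hD.tsum_mul_abs_sub_le x (fun p => inter_subset_left) hw (hw'' n)
  have h2 : ∑' p, S.indicator K p * (|z - z| +
      setSum (S.indicator K) ({q | x q < x p} \ ({q | x q < x p} ∩ B n)))
      ≤ (∑' p, S.indicator K p) * setSum (S.indicator K) (B n)ᶜ := by
    rw [← tsum_mul_right]
    have hle : ∀ p, S.indicator K p * (|z - z| +
        setSum (S.indicator K) ({q | x q < x p} \ ({q | x q < x p} ∩ B n)))
        ≤ S.indicator K p * setSum (S.indicator K) (B n)ᶜ := fun p => by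
      rw [sub_self, abs_zero, zero_add]
      refine mul_le_mul_of_nonneg_left (setSum_mono hS hD.nonneg ?_) (hD.nonneg p)
      exact fun q hq hq' => hq.2 ⟨hq.1, hq'⟩
    refine (Summable.of_nonneg_of_le (fun p => ?_) hle (hS.mul_right _)).tsum_le_tsum hle
      (hS.mul_right _)
    exact mul_nonneg (hD.nonneg p) (add_nonneg (abs_nonneg _) (setSum_nonneg hD.nonneg _))
  have h3 := mul_le_mul_of_nonneg_left h2 (gronwallConst_nonneg hD.nonneg)
  have h4 := hD.abs_setSum_sub_le hb ({q | x q ≤ t} ∩ B n)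
  have h5 := setSum_le_tsum hs h0 ({q | x q ≤ t} ∩ B n)
  have h6 : setSum (fun q => cutoff S F q (w q)) {q | x q ≤ t}
      = setSum (fun q => cutoff S F q (w q)) ({q | x q ≤ t} ∩ B n)
        + setSum (fun q => cutoff S F q (w q)) ({q | x q ≤ t} \ B n) := by
    rw [← setSum_union (hD.summable_apply w)
      (disjoint_sdiff_right.mono_left inter_subset_right), inter_union_sdiff]
  have h7 := abs_setSum_le hS (fun q => hD.bound q (w q)) ({q | x q ≤ t} \ B n)
  have h8 : setSum (S.indicator K) ({q | x q ≤ t} \ B n) ≤ setSum (S.indicator K) (B n)ᶜ :=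
    setSum_mono hS hD.nonneg fun q hq => hq.2
  rw [hcut, h6, abs_sub_comm, add_sub_right_comm]
  refine (abs_add_le _ _).trans (add_le_add ?_ (h7.trans h8))
  exact h4.trans (h5.trans (h1.trans h3))

end IsMajorized

/-! ### Size and Lipschitz bounds for the self-stabilizing jumps -/

/-- The jump at the point `q` of the plane of a self-stabilizing process at the level `z`. -/
noncomputable def jumpSize (α : ℝ → ℝ) (q : ℝ × ℝ) (z : ℝ) : ℝ := signedPow q.2 (-1 / α z)

/-- A bound for the jump at `q` and its Lipschitz constant, when `α` has values in `[a, b]` and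
derivative at most `C`. -/
noncomputable def jumpBound (a b C : ℝ) (q : ℝ × ℝ) : ℝ :=
  (|q.2| ^ (-1 / a) + |q.2| ^ (-1 / b)) * (1 + |Real.log (|q.2|)| * (C / a ^ 2))

theorem signedPow_zero_left (s : ℝ) : signedPow 0 s = 0 := by simp [signedPow]

theorem abs_signedPow {y : ℝ} (hy : y ≠ 0) (s : ℝ) : |signedPow y s| = |y| ^ s := by
  rw [signedPow, abs_mul, abs_of_nonneg (Real.rpow_nonneg (abs_nonneg y) s)]
  rcases Real.sign_apply_eq_of_ne_zero y hy with h | h <;> simp [h]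

theorem abs_signedPow_sub {y : ℝ} (hy : y ≠ 0) (s s' : ℝ) :
    |signedPow y s - signedPow y s'| = |(|y| ^ s - |y| ^ s')| := by
  rw [signedPow, signedPow, ← mul_sub, abs_mul]
  rcases Real.sign_apply_eq_of_ne_zero y hy with h | h <;> simp [h]

theorem rpow_le_rpow_add_rpow {y r s t : ℝ} (hy : 0 < y) (hrs : r ≤ s) (hst : s ≤ t) :
    y ^ s ≤ y ^ r + y ^ t := by
  rcases le_total 1 y with h | h
  · exact (Real.rpow_le_rpow_of_exponent_le h hst).trans
      (le_add_of_nonneg_left (Real.rpow_nonneg hy.le _))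
  · exact (Real.rpow_le_rpow_of_exponent_ge hy h hrs).trans
      (le_add_of_nonneg_right (Real.rpow_nonneg hy.le _))

section Coefficients

variable {a b C : ℝ} {α : ℝ → ℝ}

theorem jumpBound_nonneg (hC : 0 ≤ C) (q : ℝ × ℝ) : 0 ≤ jumpBound a b C q := by
  unfold jumpBound
  positivity

/-- Mean value inequality for x ↦ y^(-1/α(x)), whose derivative is y^(-1/α) log y · α'/α². The sum
of two powers of y covers both y ≤ 1 and y ≥ 1. -/
theorem abs_rpow_sub_rpow_le (ha : 0 < a) (hα : Differentiable ℝ α)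
    (hα' : ∀ x, |deriv α x| ≤ C) (hαab : ∀ x, α x ∈ Icc a b) {y : ℝ} (hy : 0 < y) (z z' : ℝ) :
    |y ^ (-1 / α z) - y ^ (-1 / α z')|
      ≤ (y ^ (-1 / a) + y ^ (-1 / b)) * (|Real.log y| * (C / a ^ 2)) * |z - z'| := by
  have hC : 0 ≤ C := (abs_nonneg _).trans (hα' 0)
  have hpos : ∀ x, 0 < α x := fun x => ha.trans_le (hαab x).1
  have hd : ∀ x, HasDerivAt (fun x => y ^ (-1 / α x))
      (Real.log y * (deriv α x / α x ^ 2) * y ^ (-1 / α x)) x := by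
    intro x
    have h1 : HasDerivAt (fun x => -1 / α x) (deriv α x / α x ^ 2) x := by
      have := ((hasDerivAt_const x (-1 : ℝ)).div (hα x).hasDerivAt (hpos x).ne')
      refine this.congr_deriv ?_
      ring
    exact (h1.const_rpow hy)
  have h := convex_univ.norm_image_sub_le_of_norm_hasDerivWithin_le
    (C := (y ^ (-1 / a) + y ^ (-1 / b)) * (|Real.log y| * (C / a ^ 2)))
    (fun x _ => (hd x).hasDerivWithinAt) (fun x _ => ?_) (mem_univ z') (mem_univ z)
  · simpa using h
  · have h1 : |deriv α x / α x ^ 2| ≤ C / a ^ 2 := by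
      rw [abs_div, abs_of_pos (pow_pos (hpos x) 2)]
      exact div_le_div₀ hC (hα' x) (pow_pos ha 2) (pow_le_pow_left₀ ha.le (hαab x).1 2)
    have h2 : y ^ (-1 / α x) ≤ y ^ (-1 / a) + y ^ (-1 / b) := by
      refine rpow_le_rpow_add_rpow hy ?_ ?_
      · rw [neg_div, neg_div, neg_le_neg_iff]
        exact one_div_le_one_div_of_le ha (hαab x).1
      · rw [neg_div, neg_div, neg_le_neg_iff]
        exact one_div_le_one_div_of_le (hpos x) (hαab x).2
    rw [Real.norm_eq_abs, abs_mul, abs_mul, abs_of_pos (Real.rpow_pos_of_pos hy _), mul_comm]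
    exact mul_le_mul h2 (mul_le_mul_of_nonneg_left h1 (abs_nonneg _)) (by positivity)
      (by positivity)

theorem isMajorized_jumpSize (ha : 0 < a) (hα : Differentiable ℝ α)
    (hα' : ∀ x, |deriv α x| ≤ C) (hαab : ∀ x, α x ∈ Icc a b) :
    IsMajorized (jumpSize α) (jumpBound a b C) := by
  have hC : 0 ≤ C := (abs_nonneg _).trans (hα' 0)
  have hpos : ∀ x, 0 < α x := fun x => ha.trans_le (hαab x).1
  refine ⟨jumpBound_nonneg hC, fun q z => ?_, fun q z z' => ?_⟩
  · by_cases hq : q.2 = 0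
    · simp [jumpSize, hq, signedPow_zero_left, jumpBound_nonneg hC]
    rw [jumpSize, abs_signedPow hq, jumpBound]
    have h2 : |q.2| ^ (-1 / α z) ≤ |q.2| ^ (-1 / a) + |q.2| ^ (-1 / b) := by
      refine rpow_le_rpow_add_rpow (abs_pos.2 hq) ?_ ?_
      · rw [neg_div, neg_div, neg_le_neg_iff]
        exact one_div_le_one_div_of_le ha (hαab z).1
      · rw [neg_div, neg_div, neg_le_neg_iff]
        exact one_div_le_one_div_of_le (hpos z) (hαab z).2
    refine h2.trans (le_mul_of_one_le_right (by positivity) ?_)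
    exact le_add_of_nonneg_right (by positivity)
  · by_cases hq : q.2 = 0
    · have := mul_nonneg (jumpBound_nonneg (a := a) (b := b) hC q) (abs_nonneg (z - z'))
      simpa [jumpSize, hq, signedPow_zero_left] using this
    rw [jumpSize, jumpSize, abs_signedPow_sub hq]
    refine (abs_rpow_sub_rpow_le ha hα hα' hαab (abs_pos.2 hq) z z').trans ?_
    refine mul_le_mul_of_nonneg_right ?_ (abs_nonneg _)
    rw [jumpBound]
    exact mul_le_mul_of_nonneg_left (le_add_of_nonneg_left zero_le_one) (by positivity)

end Coefficients

/-! ### Càdlàg paths and their left limits at the points -/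

section Paths

variable {t₀ t₁ a₀ : ℝ} {α : ℝ → ℝ} {K : ℝ × ℝ → ℝ} {S : Set (ℝ × ℝ)}

theorem inter_Ioc_prod_eq (hS : S ⊆ Ioo t₀ t₁ ×ˢ univ) (t : ℝ) :
    S ∩ Ioc t₀ t ×ˢ univ = S ∩ {q | q.1 ≤ t} := by
  ext q
  exact ⟨fun h => ⟨h.1, h.2.1.2⟩, fun h => ⟨h.1, ⟨(hS h.1).1.1, h.2⟩, mem_univ _⟩⟩

theorem isCadlagOn_add_setSum {c : ℝ × ℝ → ℝ} (hc : Summable c) {f : ℝ → ℝ}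
    (hf : ∀ t ∈ Ico t₀ t₁, f t = a₀ + setSum c {q | q.1 ≤ t}) : IsCadlagOn t₀ t₁ f := by
  refine ⟨fun u hu => ?_, fun u hu => ⟨a₀ + setSum c {q | q.1 < u}, ?_⟩⟩
  · rw [hf u hu]
    refine ((tendsto_setSum_le_nhdsGT hc u).const_add a₀).congr' ?_
    filter_upwards [Ioo_mem_nhdsGT hu.2] with t ht
    exact (hf t ⟨hu.1.trans ht.1.le, ht.2⟩).symm
  · refine ((tendsto_setSum_le_nhdsLT hc u).const_add a₀).congr' ?_
    filter_upwards [Ioo_mem_nhdsLT hu.1] with t ht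
    exact (hf t ⟨ht.1.le, ht.2.trans_le hu.2⟩).symm

/-- The left limit drops the jumps at u itself. This is the origin of the strict inequality in the
equation for w, and it links paths with solutions in both directions. -/
theorem leftLim_add_setSum {c : ℝ × ℝ → ℝ} (hc : Summable c) {f : ℝ → ℝ}
    (hf : ∀ t ∈ Ico t₀ t₁, f t = a₀ + setSum c {q | q.1 ≤ t}) {u : ℝ} (hu : u ∈ Ioo t₀ t₁) :
    Function.leftLim f u = a₀ + setSum c {q | q.1 < u} := by
  refine leftLim_eq_of_tendsto (((tendsto_setSum_le_nhdsLT hc u).const_add a₀).congr' ?_)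
  filter_upwards [Ioo_mem_nhdsLT hu.1] with t ht
  exact (hf t ⟨ht.1.le, ht.2.trans hu.2⟩).symm

theorem satisfiesJumpEquation_iff (hS : S ⊆ Ioo t₀ t₁ ×ˢ univ) (f : ℝ → ℝ) :
    SatisfiesJumpEquation t₀ t₁ a₀ α S f ↔ ∀ t ∈ Ico t₀ t₁,
      HasSum ({q : ℝ × ℝ | q.1 ≤ t}.indicator
        fun q => cutoff S (jumpSize α) q (Function.leftLim f q.1)) (f t - a₀) := by
  refine forall₂_congr fun t _ => ?_
  have h := hasSum_subtype_iff_indicator (s := S) (a := f t - a₀)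
    (f := fun q : ℝ × ℝ => (Ioc t₀ t).indicator (fun _ => (1 : ℝ)) q.1 *
      signedPow q.2 (-1 / α (Function.leftLim f q.1)))
  rw [show S.indicator _ = ({q : ℝ × ℝ | q.1 ≤ t}.indicator
        fun q => cutoff S (jumpSize α) q (Function.leftLim f q.1)) from ?_] at h
  · exact h
  · ext q
    by_cases hq : q ∈ S
    · have h1 := (hS hq).1.1
      by_cases ht : q.1 ≤ t <;> simp [cutoff, jumpSize, hq, ht, h1]
    · rw [indicator_of_notMem hq]
      by_cases ht : q.1 ≤ t <;> simp [cutoff, hq, ht]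

variable (hF : IsMajorized (jumpSize α) K) (hK : Summable (S.indicator K))
  (hS : S ⊆ Ioo t₀ t₁ ×ˢ univ)

include hF hK hS

theorem isCadlagOn_and_satisfiesJumpEquation {w : ℝ × ℝ → ℝ}
    (hw : IsJumpSolution (fun p => {q | q.1 < p.1}) (cutoff S (jumpSize α)) a₀ w)
    {f : ℝ → ℝ} (hf : ∀ t ∈ Ico t₀ t₁,
      f t = a₀ + setSum (fun q => cutoff S (jumpSize α) q (w q)) {q | q.1 ≤ t}) :
    IsCadlagOn t₀ t₁ f ∧ SatisfiesJumpEquation t₀ t₁ a₀ α S f := by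
  have hc := (hF.isDominated hK).summable_apply w
  refine ⟨isCadlagOn_add_setSum hc hf, (satisfiesJumpEquation_iff hS f).2 fun t ht => ?_⟩
  have h : (fun q => cutoff S (jumpSize α) q (Function.leftLim f q.1))
      = fun q => cutoff S (jumpSize α) q (w q) := by
    ext q
    by_cases hq : q ∈ S
    · rw [leftLim_add_setSum hc hf (hS hq).1, hw q]
    · simp [cutoff, hq]
  rw [h, hf t ht, add_sub_cancel_left]
  exact (hc.indicator _).hasSum

theorem exists_isJumpSolution_of_satisfiesJumpEquation {f : ℝ → ℝ}
    (hf : SatisfiesJumpEquation t₀ t₁ a₀ α S f) :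
    ∃ w, IsJumpSolution (fun p => {q | q.1 < p.1}) (cutoff S (jumpSize α)) a₀ w ∧
      ∀ t ∈ Ico t₀ t₁,
        f t = a₀ + setSum (fun q => cutoff S (jumpSize α) q (w q)) {q | q.1 ≤ t} := by
  rw [satisfiesJumpEquation_iff hS] at hf
  set c : ℝ × ℝ → ℝ := fun q => cutoff S (jumpSize α) q (Function.leftLim f q.1) with hc
  have hcs : Summable c := (hF.isDominated hK).summable_apply _
  have hfc : ∀ t ∈ Ico t₀ t₁, f t = a₀ + setSum c {q | q.1 ≤ t} := fun t ht => by
    rw [setSum, (hf t ht).tsum_eq, add_sub_cancel]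
  set w : ℝ × ℝ → ℝ := fun p => a₀ + setSum c {q | q.1 < p.1} with hw
  have hcw : (fun q => cutoff S (jumpSize α) q (w q)) = c := by
    ext q
    by_cases hq : q ∈ S
    · rw [hw, hc]
      beta_reduce
      rw [leftLim_add_setSum hcs hfc (hS hq).1]
    · simp [cutoff, hc, hq]
  exact ⟨w, fun p => by rw [hcw], fun t ht => by rw [hcw, hfc t ht]⟩

/-- The path `t ↦ setFlow (S ∩ (t₀, t] × ℝ) a₀` solves the jump equation. -/
theorem exists_isJumpSolution_setFlow :
    ∃ w, IsJumpSolution (fun p => {q | q.1 < p.1}) (cutoff S (jumpSize α)) a₀ w ∧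
      ∀ t, setFlow Prod.fst (jumpSize α) K (S ∩ Ioc t₀ t ×ˢ univ) a₀
        = a₀ + setSum (fun q => cutoff S (jumpSize α) q (w q)) {q | q.1 ≤ t} := by
  obtain ⟨w, hw⟩ := (hF.isDominated hK).exists_isJumpSolution Prod.fst a₀
  refine ⟨w, hw, fun t => ?_⟩
  rw [inter_Ioc_prod_eq hS, hF.setFlow_eq_setSum hK hw]

theorem setFlow_path :
    IsCadlagOn t₀ t₁ (fun t => setFlow Prod.fst (jumpSize α) K (S ∩ Ioc t₀ t ×ˢ univ) a₀) ∧
      SatisfiesJumpEquation t₀ t₁ a₀ α S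
        (fun t => setFlow Prod.fst (jumpSize α) K (S ∩ Ioc t₀ t ×ˢ univ) a₀) := by
  obtain ⟨w, hw, h⟩ := exists_isJumpSolution_setFlow (a₀ := a₀) hF hK hS
  exact isCadlagOn_and_satisfiesJumpEquation hF hK hS hw fun t _ => h t

theorem setFlow_Ioc {s t : ℝ} (hst : s ≤ t) :
    setFlow Prod.fst (jumpSize α) K (S ∩ Ioc t₀ t ×ˢ univ) a₀
      = setFlow Prod.fst (jumpSize α) K (S ∩ Ioc s t ×ˢ univ)
        (setFlow Prod.fst (jumpSize α) K (S ∩ Ioc t₀ s ×ˢ univ) a₀) := by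
  obtain ⟨w, hw⟩ := (hF.isDominated hK).exists_isJumpSolution Prod.fst a₀
  rw [inter_Ioc_prod_eq hS, inter_Ioc_prod_eq hS, hF.setFlow_restart hK hw hst]
  congr 2
  ext q
  simp

theorem tendsto_iSup_enorm_sub {f : ℕ → ℝ → ℝ}
    (hf : ∀ n : ℕ, SatisfiesJumpEquation t₀ t₁ a₀ α {p ∈ S | |p.2| ≤ n} (f n)) :
    Tendsto (fun n : ℕ => ⨆ t ∈ Ico t₀ t₁,
      ‖f n t - setFlow Prod.fst (jumpSize α) K (S ∩ Ioc t₀ t ×ˢ univ) a₀‖ₑ) atTop (𝓝 0) := by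
  obtain ⟨w, hw, hwf⟩ := exists_isJumpSolution_setFlow (a₀ := a₀) hF hK hS
  have hsub : ∀ n : ℕ, S ∩ {p | |p.2| ≤ n} ⊆ S := fun n => inter_subset_left
  choose w' hw' hwf' using fun n : ℕ => exists_isJumpSolution_of_satisfiesJumpEquation
    (S := S ∩ {p | |p.2| ≤ n}) hF (hK.indicator_subset (hsub n)) ((hsub n).trans hS) (hf n)
  obtain ⟨δ, hδ, hle⟩ := hF.exists_tendsto_zero_abs_setSum_sub_le hK hw
    (B := fun n : ℕ => {p | |p.2| ≤ n}) (fun q => by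
      filter_upwards [eventually_ge_atTop ⌈|q.2|⌉₊] with n hn
      exact Nat.ceil_le.1 hn) hw'
  refine tendsto_of_tendsto_of_tendsto_of_le_of_le tendsto_const_nhds
    (by simpa using ENNReal.tendsto_ofReal hδ) (fun _ => zero_le) fun n =>
    iSup₂_le fun t ht => ?_
  rw [hwf', hwf, add_sub_add_left_eq_sub, Real.enorm_eq_ofReal_abs]
  · exact ENNReal.ofReal_le_ofReal (hle n t)
  · exact ht

end Paths

/-! ### Measurability with respect to the counts in a set -/

/-- The σ-algebra generated by the numbers of points in the measurable subsets of `Q`. -/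
noncomputable abbrev countSigma {Ω E : Type*} [MeasurableSpace E] (Pi : Ω → Set E) (Q : Set E) :
    MeasurableSpace Ω :=
  ⨆ (A : Set E) (_ : MeasurableSet A) (_ : A ⊆ Q),
    MeasurableSpace.comap (pointCount Pi A) inferInstance

section Measurability

variable {Ω E : Type*} [MeasurableSpace E] {Pi : Ω → Set E} {Q : Set E}

theorem measurable_pointCount_countSigma {A : Set E} (hA : MeasurableSet A) (hAQ : A ⊆ Q) :
    Measurable[countSigma Pi Q] (pointCount Pi A) := by
  rw [measurable_iff_comap_le]
  exact le_iSup_of_le A (le_iSup_of_le hA (le_iSup_of_le hAQ le_rfl))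

variable [MeasurableSingletonClass E] (hPi : ∀ ω, (Pi ω).Countable)

theorem tsum_indicator_eq_lintegral {S : Set E} (hS : S.Countable) (f : E → ENNReal) :
    ∑' p, S.indicator f p = ∫⁻ p in S, f p ∂Measure.count := by
  rw [lintegral_countable f hS, ← tsum_subtype]
  simp

include hPi

/-- The sum is the integral of f against counting measure on the points in Q, a random measure whose
values are counts in subsets of Q. -/
theorem measurable_tsum_indicator (hQ : MeasurableSet Q) {f : E → ENNReal} (hf : Measurable f) :
    Measurable[countSigma Pi Q] fun ω => ∑' p, (Pi ω ∩ Q).indicator f p := by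
  let _ : MeasurableSpace Ω := countSigma Pi Q
  have hc : ∀ ω, (Pi ω ∩ Q).Countable := fun ω => (hPi ω).mono inter_subset_left
  simp only [fun ω => tsum_indicator_eq_lintegral (hc ω) f]
  have hN : Measurable fun ω => (Measure.count : Measure E).restrict (Pi ω ∩ Q) := by
    refine Measure.measurable_of_measurable_coe _ fun A hA => ?_
    have : ∀ ω, (Measure.count : Measure E).restrict (Pi ω ∩ Q) A
        = ((pointCount Pi (A ∩ Q) ω : ℕ∞) : ENNReal) := by
      intro ω
      rw [Measure.restrict_apply hA,
        Measure.count_apply (hA.inter (hc ω).measurableSet), pointCount]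
      congr 2
      ext q
      simp only [mem_inter_iff]
      tauto
    simp only [this]
    exact (measurable_of_countable _).comp
      (measurable_pointCount_countSigma (hA.inter hQ) inter_subset_right)
  exact (Measure.measurable_lintegral hf).comp hN

theorem measurableSet_summable_indicator (hQ : MeasurableSet Q) {K : E → ℝ}
    (hK : Measurable K) (hK0 : ∀ q, 0 ≤ K q) :
    MeasurableSet[countSigma Pi Q] {ω | Summable ((Pi ω ∩ Q).indicator K)} := by
  have h := measurable_tsum_indicator hPi hQ hK.ennreal_ofReal
  have h2 : {ω | Summable ((Pi ω ∩ Q).indicator K)}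
      = (fun ω => ∑' p, (Pi ω ∩ Q).indicator (fun q => ENNReal.ofReal (K q)) p) ⁻¹' {⊤}ᶜ := by
    ext ω
    have h3 : ∀ p, (Pi ω ∩ Q).indicator (fun q => ENNReal.ofReal (K q)) p
        = ENNReal.ofReal ((Pi ω ∩ Q).indicator K p) := fun p => by
      by_cases hp : p ∈ Pi ω ∩ Q <;> simp [hp]
    simp only [h3, mem_preimage, mem_compl_iff, mem_singleton_iff, mem_ofPred_eq]
    refine ⟨fun hs => hs.tsum_ofReal_ne_top, fun hs => ?_⟩
    have := ENNReal.summable_toReal hs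
    refine this.congr fun p => ?_
    rw [ENNReal.toReal_ofReal (indicator_nonneg (fun q _ => hK0 q) p)]
  rw [h2]
  exact h (measurableSet_singleton _).compl

open Classical in
theorem measurable_ite_tsum_indicator (hQ : MeasurableSet Q) {K g : E → ℝ}
    (hK : Measurable K) (hK0 : ∀ q, 0 ≤ K q) (hg : Measurable g) (hgK : ∀ q, |g q| ≤ K q) :
    Measurable[countSigma Pi Q] fun ω =>
      if Summable ((Pi ω ∩ Q).indicator K) then ∑' p, (Pi ω ∩ Q).indicator g p else 0 := by
  let _ : MeasurableSpace Ω := countSigma Pi Q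
  have h1 := (measurable_tsum_indicator hPi hQ hg.ennreal_ofReal).ennreal_toReal
  have h2 := (measurable_tsum_indicator hPi hQ hg.neg.ennreal_ofReal).ennreal_toReal
  have h3 := (h1.sub h2).indicator (measurableSet_summable_indicator hPi hQ hK hK0)
  convert h3 using 2 with ω
  by_cases hs : Summable ((Pi ω ∩ Q).indicator K)
  · rw [if_pos hs, indicator_of_mem (by exact hs)]
    have hbd : ∀ f : E → ℝ, (∀ q, |f q| ≤ K q) → Summable fun p =>
        ((Pi ω ∩ Q).indicator (fun q => ENNReal.ofReal (f q)) p).toReal := by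
      refine fun f hf => hs.of_nonneg_of_le (fun p => ENNReal.toReal_nonneg) fun p => ?_
      by_cases hp : p ∈ Pi ω ∩ Q
      · rw [indicator_of_mem hp, indicator_of_mem hp, ENNReal.toReal_ofReal']
        exact max_le ((le_abs_self _).trans (hf p)) (hK0 p)
      · simp [hp]
    have hfin : ∀ f : E → ℝ, ∀ p,
        (Pi ω ∩ Q).indicator (fun q => ENNReal.ofReal (f q)) p ≠ ⊤ := fun f p => by
      by_cases hp : p ∈ Pi ω ∩ Q <;> simp [hp]
    rw [_root_.Pi.sub_apply, ENNReal.tsum_toReal_eq (hfin g), ENNReal.tsum_toReal_eq (hfin (-g)),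
      ← (hbd g hgK).tsum_sub (hbd (-g) fun q => by simpa using hgK q)]
    refine tsum_congr fun p => ?_
    by_cases hp : p ∈ Pi ω ∩ Q
    · simp only [indicator_of_mem hp, ENNReal.toReal_ofReal', _root_.Pi.neg_apply]
      exact (max_zero_sub_max_neg_zero_eq_self (g p)).symm
    · simp [hp]
  · rw [if_neg hs, indicator_of_notMem (by exact hs)]

open Classical in
-- Lipschitz in z and measurable in ω, hence jointly measurable; an Euler step evaluates this sum at
-- a random z.
theorem measurable_uncurry_ite_setSum (hQ : MeasurableSet Q) {F : E → ℝ → ℝ} {K : E → ℝ}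
    (hF : IsMajorized F K) (hK : Measurable K) (hFm : ∀ z, Measurable fun q => F q z)
    {A : Set E} (hA : MeasurableSet A) :
    Measurable[(inferInstance : MeasurableSpace ℝ).prod (countSigma Pi Q)]
      (Function.uncurry fun (z : ℝ) ω => if Summable ((Pi ω ∩ Q).indicator K) then
        setSum (fun q => cutoff (Pi ω ∩ Q) F q z) A else 0) := by
  refine measurable_uncurry_of_continuous_of_measurable (fun ω => ?_) fun z => ?_
  · by_cases hs : Summable ((Pi ω ∩ Q).indicator K)
    · simp only [if_pos hs]
      have hD := hF.isDominated hs
      refine (LipschitzWith.of_dist_le' (K := ∑' q, (Pi ω ∩ Q).indicator K q)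
        fun z z' => ?_).continuous
      have h1 := hD.abs_setSum_sub_le (w := fun _ => z) (w' := fun _ => z') ⟨_, fun _ => le_rfl⟩ A
      refine h1.trans ((setSum_le_tsum (hs.mul_right _)
        (fun q => mul_nonneg (hD.nonneg q) (abs_nonneg _)) A).trans_eq ?_)
      rw [tsum_mul_right, Real.dist_eq]
    · simp only [if_neg hs]
      exact continuous_const
  · have h := measurable_ite_tsum_indicator hPi hQ hK hF.nonneg ((hFm z).indicator hA)
      (fun q => by
        by_cases hq : q ∈ A
        · simpa [hq] using hF.bound q z
        · simpa [hq] using hF.nonneg q)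
    convert h using 3 with ω
    refine tsum_congr fun q => ?_
    by_cases hq : q ∈ A <;> by_cases hq' : q ∈ Pi ω <;> by_cases hq'' : q ∈ Q <;>
      simp [cutoff, hq, hq', hq'']

open Classical in
theorem measurable_ite_eulerScheme (hQ : MeasurableSet Q) {F : E → ℝ → ℝ} {K : E → ℝ}
    (hF : IsMajorized F K) (hK : Measurable K) (hFm : ∀ z, Measurable fun q => F q z)
    {c : E → ℕ} (hc : Measurable c) (z : ℝ) (k : ℕ) :
    Measurable[countSigma Pi Q] fun ω => if Summable ((Pi ω ∩ Q).indicator K) then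
      eulerScheme c (cutoff (Pi ω ∩ Q) F) z k else z := by
  let _ : MeasurableSpace Ω := countSigma Pi Q
  induction k with
  | zero => simp [eulerScheme]
  | succ k ih =>
    have hJ := measurable_uncurry_ite_setSum hPi hQ hF hK hFm (hc (measurableSet_singleton k))
    have h := ih.add (hJ.comp (ih.prodMk measurable_id))
    convert h using 1
    ext ω
    by_cases hs : Summable ((Pi ω ∩ Q).indicator K)
    · simp [hs, eulerScheme, preimage]
    · simp [hs]

/-- The solution is obtained by choice, so its measurability is read off from Euler schemes of mesh
1/n, which converge to it for every ω with summable weights. -/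
theorem measurable_setFlow (hQ : MeasurableSet Q) {F : E → ℝ → ℝ} {K : E → ℝ}
    (hF : IsMajorized F K) (hK : Measurable K) (hFm : ∀ z, Measurable fun q => F q z)
    {x : E → ℝ} (hx : Measurable x) {s t : ℝ} (hQx : ∀ q ∈ Q, x q ∈ Icc s t) (z : ℝ) :
    Measurable[countSigma Pi Q] fun ω => setFlow x F K (Pi ω ∩ Q) z := by
  classical
  let _ : MeasurableSpace Ω := countSigma Pi Q
  have hc : ∀ n : ℕ, Measurable fun q => ⌊n * (x q - s)⌋₊ := fun n =>
    Nat.measurable_floor.comp ((hx.sub_const s).const_mul _)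
  -- The extra step `+ 1` processes the last cell, which contains the points with abscissa t.
  refine measurable_of_tendsto_metrizable (fun n : ℕ => measurable_ite_eulerScheme hPi hQ hF hK
    hFm (hc n) z (⌊n * (t - s)⌋₊ + 1)) (tendsto_pi_nhds.2 fun ω => ?_)
  by_cases hs : Summable ((Pi ω ∩ Q).indicator K)
  · simp only [setFlow, if_pos hs]
    have hmem : ∀ q, (Pi ω ∩ Q).indicator K q ≠ 0 → x q ∈ Icc s t := fun q hq =>
      hQx q (mem_of_indicator_ne_zero hq).2
    refine (hF.isDominated hs).tendsto_eulerScheme x z (fun n p q h => ?_) (fun n q hq => ?_)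
      fun p q hp hq hqp => ?_
    · by_contra! h'
      refine absurd h (not_lt.2 (Nat.floor_le_floor ?_))
      exact mul_le_mul_of_nonneg_left (sub_le_sub_right h' _) n.cast_nonneg
    · refine Nat.lt_succ_of_le (Nat.floor_le_floor ?_)
      exact mul_le_mul_of_nonneg_left (sub_le_sub_right (hmem q hq).2 _) n.cast_nonneg
    · obtain ⟨m, hm⟩ := exists_nat_gt (1 / (x p - x q))
      filter_upwards [eventually_ge_atTop m] with n hn
      have h0 : 0 < x p - x q := sub_pos.2 hqp
      have h1 : 1 < n * (x p - x q) := by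
        rw [div_lt_iff₀ h0] at hm
        exact hm.trans_le (mul_le_mul_of_nonneg_right (Nat.cast_le.2 hn) h0.le)
      have h2 : 0 ≤ n * (x q - s) := mul_nonneg n.cast_nonneg (sub_nonneg.2 (hmem q hq).1)
      refine Nat.lt_of_succ_le (Nat.le_floor ?_)
      have h3 := Nat.floor_le h2
      push_cast
      linarith
  · simp [setFlow, hs]

theorem measurable_uncurry_setFlow (hQ : MeasurableSet Q) {F : E → ℝ → ℝ} {K : E → ℝ}
    (hF : IsMajorized F K) (hK : Measurable K) (hFm : ∀ z, Measurable fun q => F q z)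
    {x : E → ℝ} (hx : Measurable x) {s t : ℝ} (hQx : ∀ q ∈ Q, x q ∈ Icc s t) :
    Measurable[(inferInstance : MeasurableSpace ℝ).prod (countSigma Pi Q)]
      (Function.uncurry fun z ω => setFlow x F K (Pi ω ∩ Q) z) :=
  measurable_uncurry_of_continuous_of_measurable (fun _ => hF.continuous_setFlow _)
    fun z => measurable_setFlow hPi hQ hF hK hFm hx hQx z

end Measurability

/-! ### Campbell's formula and almost sure summability -/

theorem lintegral_natCast_poissonMeasure (r : NNReal) :
    ∫⁻ k : ℕ, (k : ENNReal) ∂(poissonMeasure r) = r := by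
  rw [lintegral_countable', tsum_eq_zero_add' ENNReal.summable]
  have h : ∀ k : ℕ, ((k + 1 : ℕ) : ENNReal) * poissonMeasure r {k + 1}
      = r * poissonMeasure r {k} := by
    intro k
    rw [poissonMeasure_singleton, poissonMeasure_singleton, ← ENNReal.ofReal_natCast,
      ← ENNReal.ofReal_coe_nnreal, ← ENNReal.ofReal_mul (by positivity),
      ← ENNReal.ofReal_mul (by positivity)]
    congr 1
    rw [Nat.factorial_succ]
    push_cast
    field_simp
    ring
  simp only [h, Nat.cast_zero, zero_mul, zero_add]
  rw [ENNReal.tsum_mul_left]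
  have h2 : ∑' k : ℕ, poissonMeasure r {k} = 1 := by
    have := lintegral_countable' (μ := poissonMeasure r) (fun _ : ℕ => (1 : ENNReal))
    simpa using this.symm
  rw [h2, mul_one]

namespace IsPoissonPointProcess

variable {Ω E : Type*} [MeasurableSpace Ω] [MeasurableSpace E] {Pi : Ω → Set E} {μ : Measure E}
  {P : Measure Ω} (h : IsPoissonPointProcess Pi μ P)

include h

theorem countSigma_le (Q : Set E) : countSigma Pi Q ≤ ‹MeasurableSpace Ω› :=
  iSup_le fun A => iSup_le fun hA => iSup_le fun _ => (h.measurable_count A hA).comap_le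

theorem lintegral_pointCount [IsProbabilityMeasure P] {A : Set E} (hA : MeasurableSet A) :
    ∫⁻ ω, ((pointCount Pi A ω : ℕ∞) : ENNReal) ∂P = μ A := by
  by_cases hμ : μ A = ⊤
  · rw [hμ, lintegral_congr_ae (g := fun _ => ⊤)]
    · simp
    · filter_upwards [h.count_eq_top A hA hμ] with ω hω
      simp [hω]
  · rw [← lintegral_map (f := fun k : ℕ∞ => (k : ENNReal)) (measurable_of_countable _)
      (h.measurable_count A hA), h.law_count A hA hμ,
      lintegral_map (measurable_of_countable _) (measurable_of_countable _)]
    simp only [ENat.toENNReal_coe]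
    rw [lintegral_natCast_poissonMeasure, ENNReal.coe_toNNReal hμ]

/-- Campbell's formula. -/
theorem lintegral_tsum_indicator [MeasurableSingletonClass E] [IsProbabilityMeasure P]
    {f : E → ENNReal} (hf : Measurable f) :
    ∫⁻ ω, ∑' p, (Pi ω).indicator f p ∂P = ∫⁻ p, f p ∂μ := by
  have hcount : ∀ A, MeasurableSet A → ∀ ω, (Measure.count : Measure E).restrict (Pi ω) A
      = ((pointCount Pi A ω : ℕ∞) : ENNReal) := by
    intro A hA ω
    rw [Measure.restrict_apply hA,
      Measure.count_apply (hA.inter (h.countable ω).measurableSet), pointCount, inter_comm]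
  have hN : Measurable fun ω => (Measure.count : Measure E).restrict (Pi ω) := by
    refine Measure.measurable_of_measurable_coe _ fun A hA => ?_
    simp only [hcount A hA]
    exact (measurable_of_countable _).comp (h.measurable_count A hA)
  -- Averaging the random counting measure over ω gives the mean measure; the formula for functions
  -- follows by integrating against this mixture.
  have hb : Measure.bind P (fun ω => (Measure.count : Measure E).restrict (Pi ω)) = μ := by
    ext A hA
    rw [Measure.bind_apply hA hN.aemeasurable]
    simp only [hcount A hA]
    exact h.lintegral_pointCount hA
  simp only [fun ω => tsum_indicator_eq_lintegral (h.countable ω) f]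
  rw [← Measure.lintegral_bind hN.aemeasurable hf.aemeasurable, hb]

theorem ae_finite_inter [IsProbabilityMeasure P] {A : Set E} (hA : MeasurableSet A)
    (hμ : μ A ≠ ⊤) : ∀ᵐ ω ∂P, (Pi ω ∩ A).Finite := by
  have hm : Measurable fun ω => ((pointCount Pi A ω : ℕ∞) : ENNReal) :=
    (measurable_of_countable _).comp (h.measurable_count A hA)
  filter_upwards [ae_lt_top hm (by rwa [h.lintegral_pointCount hA])] with ω hω
  rw [← Set.encard_lt_top_iff]
  simpa [pointCount] using hω

/-- If the mean of the sum of `K` over the points outside `A` is finite, and so is the mean number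
of points in `A`, then `K` is almost surely summable. -/
theorem ae_summable_indicator [MeasurableSingletonClass E] [IsProbabilityMeasure P]
    {A : Set E} (hA : MeasurableSet A) (hμ : μ A ≠ ⊤) {K : E → ℝ} (hK : Measurable K)
    (hK0 : ∀ q, 0 ≤ K q) (hint : ∫⁻ p in Aᶜ, ENNReal.ofReal (K p) ∂μ ≠ ⊤) :
    ∀ᵐ ω ∂P, Summable ((Pi ω).indicator K) := by
  have hf : Measurable (Aᶜ.indicator fun p => ENNReal.ofReal (K p)) :=
    hK.ennreal_ofReal.indicator hA.compl
  have hm : Measurable fun ω => ∑' p, (Pi ω).indicator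
      (Aᶜ.indicator fun p => ENNReal.ofReal (K p)) p := by
    have := (measurable_tsum_indicator h.countable MeasurableSet.univ hf).mono
      (h.countSigma_le univ) le_rfl
    simpa using this
  have hfin := h.lintegral_tsum_indicator hf
  rw [lintegral_indicator hA.compl] at hfin
  filter_upwards [h.ae_finite_inter hA hμ, ae_lt_top hm (by rwa [hfin])] with ω h1 h2
  have h3 : Summable ((Pi ω ∩ A).indicator K) :=
    summable_of_hasFiniteSupport (h1.subset fun q hq => mem_of_indicator_ne_zero hq)
  have h4 : Summable ((Pi ω \ A).indicator K) := by
    refine (ENNReal.summable_toReal h2.ne).congr fun p => ?_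
    by_cases hp : p ∈ Pi ω <;> by_cases hp' : p ∈ A <;> simp [hp, hp', hK0 p]
  refine (h3.add h4).congr fun p => ?_
  by_cases hp : p ∈ Pi ω <;> by_cases hp' : p ∈ A <;> simp [hp, hp']

end IsPoissonPointProcess

/-! ### Integrability of the jump bound -/

section JumpBound

variable {a b C : ℝ}

theorem measurable_jumpBound (a b C : ℝ) : Measurable (jumpBound a b C) := by
  unfold jumpBound
  fun_prop

theorem measurable_jumpSize (α : ℝ → ℝ) (z : ℝ) : Measurable fun q => jumpSize α q z := by
  have hs : Measurable Real.sign :=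
    Measurable.ite measurableSet_Iio measurable_const
      (Measurable.ite measurableSet_Ioi measurable_const measurable_const)
  unfold jumpSize signedPow
  exact (hs.comp measurable_snd).mul (by fun_prop)

theorem exists_jumpBound_le (ha : 0 < a) (hab : a ≤ b) (hb : b < 1) (hC : 0 ≤ C) :
    ∃ D r : ℝ, 1 < r ∧ ∀ q : ℝ × ℝ, 1 < |q.2| → jumpBound a b C q ≤ D * (1 + ‖q.2‖) ^ (-r) := by
  have hb0 : 0 < b := ha.trans_le hab
  have hb1 : 1 < 1 / b := by rwa [lt_div_iff₀ hb0, one_mul]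
  -- Half of the excess of 1/b over 1 is spent on the logarithm; the remaining exponent r = (1 +
  -- 1/b)/2 still exceeds 1.
  set δ := (1 / b - 1) / 2 with hδ
  have hδ0 : 0 < δ := by rw [hδ]; linarith
  set r := 1 / b - δ with hr
  have hr1 : 1 < r := by rw [hr, hδ]; linarith
  refine ⟨2 ^ r * (2 * (1 + 1 / δ * (C / a ^ 2))), r, hr1, fun q hq => ?_⟩
  rw [Real.norm_eq_abs]
  set y := |q.2| with hy
  have hy0 : 0 < y := zero_lt_one.trans hq
  have h1 : y ^ (-1 / a) ≤ y ^ (-1 / b) := by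
    refine Real.rpow_le_rpow_of_exponent_le hq.le ?_
    rw [neg_div, neg_div, neg_le_neg_iff]
    exact one_div_le_one_div_of_le ha hab
  have hyδ : 1 ≤ y ^ δ := Real.one_le_rpow hq.le hδ0.le
  have h2 : |Real.log y| ≤ y ^ δ * (1 / δ) := by
    rw [abs_of_nonneg (Real.log_nonneg hq.le), mul_one_div]
    exact Real.log_le_rpow_div hy0.le hδ0
  have hCa : 0 ≤ C / a ^ 2 := by positivity
  have h3 : 1 + |Real.log y| * (C / a ^ 2) ≤ y ^ δ * (1 + 1 / δ * (C / a ^ 2)) := by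
    nlinarith [mul_le_mul_of_nonneg_right h2 hCa]
  have h4 : jumpBound a b C q
      ≤ (2 * y ^ (-1 / b)) * (y ^ δ * (1 + 1 / δ * (C / a ^ 2))) := by
    rw [jumpBound]
    exact mul_le_mul (by linarith) h3 (by positivity) (by positivity)
  have h5 : y ^ (-1 / b) * y ^ δ = y ^ (-r) := by
    rw [← Real.rpow_add hy0]
    congr 1
    rw [hr]
    ring
  -- Uses 1 + y ≤ 2y, valid since y > 1.
  have h6 : y ^ (-r) ≤ 2 ^ r * (1 + y) ^ (-r) := by
    have h7 : (2 : ℝ) ^ r * (2 * y) ^ (-r) = y ^ (-r) := by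
      rw [Real.mul_rpow two_pos.le hy0.le, ← mul_assoc, ← Real.rpow_add two_pos]
      simp
    rw [← h7]
    refine mul_le_mul_of_nonneg_left ?_ (by positivity)
    exact Real.rpow_le_rpow_of_nonpos (by linarith) (by linarith) (by linarith)
  calc jumpBound a b C q ≤ _ := h4
    _ = y ^ (-r) * (2 * (1 + 1 / δ * (C / a ^ 2))) := by rw [← h5]; ring
    _ ≤ 2 ^ r * (1 + y) ^ (-r) * (2 * (1 + 1 / δ * (C / a ^ 2))) :=
      mul_le_mul_of_nonneg_right h6 (by positivity)
    _ = _ := by ring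

theorem lintegral_jumpBound_ne_top (ha : 0 < a) (hab : a ≤ b) (hb : b < 1) (hC : 0 ≤ C)
    (t₀ t₁ : ℝ) :
    ∫⁻ q in {q : ℝ × ℝ | |q.2| ≤ 1}ᶜ, ENNReal.ofReal (jumpBound a b C q)
      ∂(volume.restrict (Ioo t₀ t₁ ×ˢ univ)) ≠ ⊤ := by
  obtain ⟨D, r, hr, hle⟩ := exists_jumpBound_le ha hab hb hC
  have hm : MeasurableSet {q : ℝ × ℝ | |q.2| ≤ 1} :=
    measurableSet_le (by fun_prop) measurable_const
  have hint : Integrable (fun y : ℝ => D * (1 + ‖y‖) ^ (-r)) :=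
    (integrable_one_add_norm (by simpa using hr)).const_mul D
  have hmy : Measurable fun y : ℝ => ENNReal.ofReal (D * (1 + ‖y‖) ^ (-r)) := by fun_prop
  refine ne_top_of_le_ne_top (b := ∫⁻ q : ℝ × ℝ, ENNReal.ofReal (D * (1 + ‖q.2‖) ^ (-r))
    ∂(volume.restrict (Ioo t₀ t₁ ×ˢ univ))) ?_ ?_
  · rw [Measure.volume_eq_prod, ← Measure.prod_restrict, Measure.restrict_univ,
      ← lintegral_map (f := fun y : ℝ => ENNReal.ofReal (D * (1 + ‖y‖) ^ (-r))) hmy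
      measurable_snd, Measure.map_snd_prod, lintegral_smul_measure]
    refine ENNReal.mul_ne_top (by simp) ?_
    exact hint.lintegral_lt_top.ne
  · refine (setLIntegral_mono (by fun_prop) fun q hq => ?_).trans (setLIntegral_le_lintegral _ _)
    exact ENNReal.ofReal_le_ofReal (hle q (not_le.1 hq))

theorem volume_strip_ne_top (t₀ t₁ : ℝ) :
    volume.restrict (Ioo t₀ t₁ ×ˢ univ) {q : ℝ × ℝ | |q.2| ≤ 1} ≠ ⊤ := by
  have hm : {q : ℝ × ℝ | |q.2| ≤ 1} = univ ×ˢ Icc (-1) 1 := by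
    ext q
    simp [abs_le]
  rw [hm, Measure.restrict_apply (MeasurableSet.univ.prod measurableSet_Icc),
    prod_inter_prod, Measure.volume_eq_prod, Measure.prod_prod]
  refine ENNReal.mul_ne_top ?_ ?_ <;> simp

end JumpBound

/-! ### Independence of the point process over disjoint sets -/

section Independence

variable {Ω E : Type*} {Pi : Ω → Set E}

/-- The atoms of a family of sets: the points that lie in exactly the sets with index in `ε`. -/
def familyAtom {κ : Type*} (A : κ → Set E) (ε : Set κ) : Set E := {p | ∀ k, p ∈ A k ↔ k ∈ ε}

theorem disjoint_familyAtom {κ : Type*} {A : κ → Set E} {ε ε' : Set κ} (h : ε ≠ ε') :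
    Disjoint (familyAtom A ε) (familyAtom A ε') :=
  Set.disjoint_left.2 fun _ h1 h2 => h (Set.ext fun k => (h1 k).symm.trans (h2 k))

/-- The count of `A k` is the finite sum of the counts of the atoms inside it, so overlapping sets
reduce to disjoint ones. Intersecting with U cuts down the atom of the empty index set, which is not
contained in U in general. -/
theorem comap_pointCount_le_iSup_familyAtom {κ : Type*} [Finite κ] {A : κ → Set E} {U : Set E}
    (hU : ∀ k, A k ⊆ U) (k : κ) :
    MeasurableSpace.comap (pointCount Pi (A k)) inferInstance
      ≤ ⨆ ε : Set κ, MeasurableSpace.comap (pointCount Pi (U ∩ familyAtom A ε))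
        inferInstance := by
  classical
  have := Fintype.ofFinite κ
  let _ : MeasurableSpace Ω := ⨆ ε : Set κ,
    MeasurableSpace.comap (pointCount Pi (U ∩ familyAtom A ε)) inferInstance
  rw [← measurable_iff_comap_le]
  have h1 : ∀ ε : Set κ, Measurable (pointCount Pi (U ∩ familyAtom A ε)) := fun ε =>
    measurable_iff_comap_le.2 (le_iSup (fun ε : Set κ =>
      MeasurableSpace.comap (pointCount Pi (U ∩ familyAtom A ε)) inferInstance) ε)
  have h2 : pointCount Pi (A k)
      = fun ω => ∑ ε : {ε : Set κ // k ∈ ε}, pointCount Pi (U ∩ familyAtom A ε) ω := by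
    ext1 ω
    have hd : Pairwise (Function.onFun Disjoint fun ε : {ε : Set κ // k ∈ ε} =>
        Pi ω ∩ (U ∩ familyAtom A ε.1)) := fun ε ε' hne =>
      (disjoint_familyAtom fun h => hne (Subtype.ext h)).mono
        (inter_subset_right.trans inter_subset_right)
        (inter_subset_right.trans inter_subset_right)
    simp only [pointCount]
    rw [← finsum_eq_sum_of_fintype, ← Set.encard_iUnion_of_finite hd]
    congr 1
    ext p
    simp only [mem_inter_iff, mem_iUnion]
    constructor
    · rintro ⟨hp, hk⟩
      exact ⟨⟨{k | p ∈ A k}, hk⟩, hp, hU k hk, fun _ => Iff.rfl⟩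
    · rintro ⟨ε, hp, -, hε⟩
      exact ⟨hp, (hε k).2 ε.2⟩
  rw [h2]
  exact Finset.measurable_sum _ fun ε _ => h1 ε

variable [MeasurableSpace E]

theorem measurableSet_familyAtom {κ : Type*} [Finite κ] {A : κ → Set E}
    (hA : ∀ k, MeasurableSet (A k)) (ε : Set κ) : MeasurableSet (familyAtom A ε) := by
  have : familyAtom A ε = ⋂ k, {p | p ∈ A k ↔ k ∈ ε} := by
    ext p
    simp [familyAtom]
  rw [this]
  refine MeasurableSet.iInter fun k => ?_
  by_cases hk : k ∈ ε
  · simpa [hk] using hA k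
  · have h : {p | p ∈ A k ↔ k ∈ ε} = (A k)ᶜ := by
      ext p
      simp [hk]
    rw [h]
    exact (hA k).compl

theorem countSigma_eq_iSup_finset (U : Set E) :
    countSigma Pi U = ⨆ i : Finset {A : Set E // MeasurableSet A ∧ A ⊆ U}, ⨆ A ∈ i,
      MeasurableSpace.comap (pointCount Pi A.1) inferInstance := by
  rw [← iSup_eq_iSup_finset, iSup_subtype, countSigma]
  simp only [iSup_and]

variable [MeasurableSpace Ω] {μ : Measure E} {P : Measure Ω}

theorem IsPoissonPointProcess.iIndepFun_pointCount (h : IsPoissonPointProcess Pi μ P)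
    {κ : Type*} [Finite κ] {A : κ → Set E} (hA : ∀ k, MeasurableSet (A k))
    (hd : Pairwise fun k l => Disjoint (A k) (A l)) : iIndepFun (fun k => pointCount Pi (A k)) P := by
  obtain ⟨n, ⟨e⟩⟩ := Finite.exists_equiv_fin κ
  have h1 := h.indep_count n (fun i => A (e.symm i)) (fun i => hA _)
    fun i j hij => hd (e.symm.injective.ne hij)
  simpa using h1.precomp e.injective

theorem IsPoissonPointProcess.indep_iSup_comap_pointCount (h : IsPoissonPointProcess Pi μ P)
    {κ κ' : Type*} [Finite κ] [Finite κ'] {U V : Set E} (hU : MeasurableSet U)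
    (hV : MeasurableSet V) (hUV : Disjoint U V) {A : κ → Set E} {B : κ' → Set E}
    (hA : ∀ k, MeasurableSet (A k)) (hAU : ∀ k, A k ⊆ U)
    (hB : ∀ k, MeasurableSet (B k)) (hBV : ∀ k, B k ⊆ V) :
    Indep (⨆ k, MeasurableSpace.comap (pointCount Pi (A k)) inferInstance)
      (⨆ k, MeasurableSpace.comap (pointCount Pi (B k)) inferInstance) P := by
  let D : Set κ ⊕ Set κ' → Set E :=
    Sum.elim (fun ε => U ∩ familyAtom A ε) (fun ε => V ∩ familyAtom B ε)
  have hD : ∀ i, MeasurableSet (D i) := by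
    rintro (ε | ε)
    · exact hU.inter (measurableSet_familyAtom hA ε)
    · exact hV.inter (measurableSet_familyAtom hB ε)
  have hdisj : Pairwise fun i j => Disjoint (D i) (D j) := by
    rintro (ε | ε) (ε' | ε') hne
    · exact (disjoint_familyAtom fun h => hne (congrArg _ h)).mono inter_subset_right
        inter_subset_right
    · exact hUV.mono inter_subset_left inter_subset_left
    · exact hUV.symm.mono inter_subset_left inter_subset_left
    · exact (disjoint_familyAtom fun h => hne (congrArg _ h)).mono inter_subset_right
        inter_subset_right
  have hind := indep_iSup_of_disjoint (fun i => (h.measurable_count (D i) (hD i)).comap_le)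
    (h.iIndepFun_pointCount hD hdisj) (S := range Sum.inl) (T := range Sum.inr)
    Set.isCompl_range_inl_range_inr.disjoint
  refine indep_of_indep_of_le_left (indep_of_indep_of_le_right hind ?_) ?_
  · refine iSup_le fun k => (comap_pointCount_le_iSup_familyAtom hBV k).trans ?_
    exact iSup_le fun ε => le_iSup₂_of_le (Sum.inr ε) (mem_range_self ε) le_rfl
  · refine iSup_le fun k => (comap_pointCount_le_iSup_familyAtom hAU k).trans ?_
    exact iSup_le fun ε => le_iSup₂_of_le (Sum.inl ε) (mem_range_self ε) le_rfl

/-- The restrictions of a Poisson point process to disjoint sets are independent. -/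
theorem IsPoissonPointProcess.indep_countSigma [IsProbabilityMeasure P]
    (h : IsPoissonPointProcess Pi μ P) {U V : Set E} (hU : MeasurableSet U)
    (hV : MeasurableSet V) (hUV : Disjoint U V) :
    Indep (countSigma Pi U) (countSigma Pi V) P := by
  have hle : ∀ (W : Set E) (i : Finset {A : Set E // MeasurableSet A ∧ A ⊆ W}),
      (⨆ A ∈ i, MeasurableSpace.comap (pointCount Pi A.1) inferInstance)
        ≤ ‹MeasurableSpace Ω› := fun W i =>
    iSup₂_le fun A _ => (h.measurable_count A.1 A.2.1).comap_le
  have hdir : ∀ W : Set E, Directed (· ≤ ·)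
      fun i : Finset {A : Set E // MeasurableSet A ∧ A ⊆ W} =>
        ⨆ A ∈ i, MeasurableSpace.comap (pointCount Pi A.1)
          (inferInstance : MeasurableSpace ℕ∞) := by
    classical
    exact fun W => Monotone.directed_le fun i j hij => biSup_mono fun A hA => Finset.mem_of_subset hij hA
  rw [countSigma_eq_iSup_finset U]
  -- Each σ-algebra is a directed supremum over finite families; independence passes to the supremum
  -- one factor at a time.
  refine indep_iSup_of_directed_le (fun i => ?_) (hle U) (h.countSigma_le V) (hdir U)
  rw [countSigma_eq_iSup_finset V]
  refine (indep_iSup_of_directed_le (fun j => ?_) (hle V) (hle U i) (hdir V)).symm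
  have := h.indep_iSup_comap_pointCount hU hV hUV (A := fun A : i => A.1.1)
    (B := fun B : j => B.1.1) (fun A => A.1.2.1) (fun A => A.1.2.2) (fun B => B.1.2.1)
    (fun B => B.1.2.2)
  rw [iSup_subtype', iSup_subtype']
  exact this.symm

end Independence

/-! ### Conditioning by freezing the past -/

section Freezing

variable {Ω Ω' E : Type*} {m m' : MeasurableSpace Ω} [mΩ : MeasurableSpace Ω] [mΩ' : MeasurableSpace Ω']
  [MeasurableSpace E] {P : Measure Ω} [IsProbabilityMeasure P]

theorem condExp_prodMk_mem_of_indep (hm : m ≤ mΩ) {X : Ω → E}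
    (hX : Measurable[m] X) {V : Ω → Ω'} (hV : Measurable V)
    (hind : Indep m (MeasurableSpace.comap V mΩ') P) {D : Set (E × Ω')} (hD : MeasurableSet D) :
    P⟦{ω | (X ω, V ω) ∈ D} | m⟧ =ᵐ[P] fun ω => P.real {ω' | (X ω, V ω') ∈ D} := by
  have hXm : Measurable X := hX.mono hm le_rfl
  have hDm : MeasurableSet {ω | (X ω, V ω) ∈ D} := (hXm.prodMk hV) hD
  have hmap : ∀ e : E, P {ω' | (e, V ω') ∈ D} = P.map V (Prod.mk e ⁻¹' D) := fun e =>
    (Measure.map_apply hV (measurable_prodMk_left hD)).symm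
  have hprob : IsProbabilityMeasure (P.map V) := Measure.isProbabilityMeasure_map hV.aemeasurable
  have hg : Measurable fun e : E => P {ω' | (e, V ω') ∈ D} := by
    simp only [hmap]
    exact measurable_measure_prodMk_left hD
  symm
  refine ae_eq_condExp_of_forall_setIntegral_eq hm
    ((integrable_const (1 : ℝ)).indicator hDm) (fun B hB _ => ?_) (fun B hB _ => ?_) ?_
  · refine Integrable.integrableOn (Integrable.of_bound (C := 1)
      (hg.comp hXm).ennreal_toReal.aestronglyMeasurable (Eventually.of_forall fun ω => ?_))
    rw [Real.norm_of_nonneg measureReal_nonneg]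
    exact measureReal_le_one
  · have hBm := hm B hB
    -- Pairing X with membership in B puts the integral over B into a joint law with V, which is a
    -- product by independence; Fubini then gives the identity.
    set Y : Ω → E × Prop := fun ω => (X ω, ω ∈ B) with hY
    have hYm : Measurable[m] Y := hX.prodMk ((@measurableSet_setOfPred Ω m (· ∈ B)).1 hB)
    have hYm' : Measurable Y := hYm.mono hm le_rfl
    have hYV : IndepFun Y V P := indep_of_indep_of_le_left hind hYm.comap_le
    have hprod := (indepFun_iff_map_prod_eq_prod_map_map hYm'.aemeasurable hV.aemeasurable).1 hYV
    have hD' : MeasurableSet {y : (E × Prop) × Ω' | y.1.2 ∧ (y.1.1, y.2) ∈ D} :=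
      (measurableSet_setOfPred.2 measurable_fst.snd).inter
        ((measurable_fst.fst.prodMk measurable_snd) hD)
    have h1 : P (B ∩ {ω | (X ω, V ω) ∈ D}) = ∫⁻ ω in B, P {ω' | (X ω, V ω') ∈ D} ∂P := by
      have h2 := congrArg (fun ν => ν {y : (E × Prop) × Ω' | y.1.2 ∧ (y.1.1, y.2) ∈ D}) hprod
      rw [Measure.map_apply (hYm'.prodMk hV) hD', Measure.prod_apply hD',
        lintegral_map (measurable_measure_prodMk_left hD') hYm'] at h2
      rw [← lintegral_indicator hBm]
      refine Eq.trans h2 (lintegral_congr fun ω => ?_)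
      by_cases hω : ω ∈ B
      · simp [hY, hω, hmap, preimage]
      · simp [hY, hω]
    rw [setIntegral_indicator hDm, setIntegral_const, smul_eq_mul, mul_one, measureReal_def, h1]
    exact integral_toReal (hg.comp hXm).aemeasurable
      (Eventually.of_forall fun ω => measure_lt_top _ _)
  · exact ((hg.comp hX).ennreal_toReal.stronglyMeasurable).aestronglyMeasurable

/-- If `Y` is a function of `X` and of randomness independent of the past `m`, the conditional law
of `Y` given `m` is its conditional law given `X`. -/
theorem condExp_preimage_eq_of_indep (hm : m ≤ mΩ) (hm' : m' ≤ mΩ)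
    (hind : Indep m m' P) {F : Type*} [MeasurableSpace F] {X : Ω → E} (hX : Measurable[m] X)
    {Φ : E → Ω → F} (hΦ : Measurable[(inferInstance : MeasurableSpace E).prod m']
      (Function.uncurry Φ)) {Y : Ω → F} (hY : ∀ᵐ ω ∂P, Y ω = Φ (X ω) ω) {A : Set F}
    (hA : MeasurableSet A) :
    P⟦Y ⁻¹' A | m⟧ =ᵐ[P] P⟦Y ⁻¹' A | MeasurableSpace.comap X inferInstance⟧ := by
  have hYA : (Y ⁻¹' A).indicator (fun _ => (1 : ℝ))
      =ᵐ[P] {ω | (X ω, ω) ∈ Function.uncurry Φ ⁻¹' A}.indicator fun _ => 1 := by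
    filter_upwards [hY] with ω hω
    have : ω ∈ Y ⁻¹' A ↔ ω ∈ {ω | (X ω, ω) ∈ Function.uncurry Φ ⁻¹' A} := by simp [hω]
    by_cases h : ω ∈ Y ⁻¹' A
    · rw [indicator_of_mem h, indicator_of_mem (this.1 h)]
    · rw [indicator_of_notMem h, indicator_of_notMem fun h' => h (this.2 h')]
  have hid : @Measurable Ω Ω mΩ m' id := fun s hs => hm' s hs
  have hindV : Indep m (MeasurableSpace.comap id m') P := by rwa [MeasurableSpace.comap_id]
  -- Freezing applies both to m and to the σ-algebra of X, with the same right-hand side.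
  have h1 := condExp_prodMk_mem_of_indep (mΩ' := m') hm hX hid hindV (hΦ hA)
  have h2 := condExp_prodMk_mem_of_indep (mΩ' := m') (hX.comap_le.trans hm)
    (comap_measurable X) hid (indep_of_indep_of_le_left hindV hX.comap_le) (hΦ hA)
  exact ((condExp_congr_ae hYA).trans h1).trans ((condExp_congr_ae hYA).trans h2).symm

end Freezing

/-! ### Assembly of the process -/

theorem mainTheorem1 {Ω : Type*} [MeasurableSpace Ω] (P : Measure Ω) [IsProbabilityMeasure P]
    (t₀ t₁ a b a₀ : ℝ) (ht : t₀ < t₁) (ha : 0 < a) (hab : a < b) (hb : b < 1)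
    (α : ℝ → ℝ) (hα : ContDiff ℝ 1 α) (hα' : ∃ C : ℝ, ∀ x, |deriv α x| ≤ C)
    (hαab : ∀ x, α x ∈ Icc a b)
    (Pi : Ω → Set (ℝ × ℝ)) (hsub : ∀ ω, Pi ω ⊆ Ioo t₀ t₁ ×ˢ univ)
    (hPi : IsPoissonPointProcess Pi (volume.restrict (Ioo t₀ t₁ ×ˢ univ)) P) :
    ∃ Z : ℝ → Ω → ℝ,
      IsMarkovProcess (fun t : Ico t₀ t₁ => Z t) (hPi.filtration t₀ t₁) P ∧
      (∀ᵐ ω ∂P, IsCadlagOn t₀ t₁ (fun t => Z t ω) ∧ Z t₀ ω = a₀ ∧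
        SatisfiesJumpEquation t₀ t₁ a₀ α (Pi ω) (fun t => Z t ω)) ∧
      (∀ n : ℕ, ∃ Zn : ℝ → Ω → ℝ, (∀ t ∈ Ico t₀ t₁, Measurable (Zn t)) ∧
        ∀ᵐ ω ∂P, IsCadlagOn t₀ t₁ (fun t => Zn t ω) ∧
          SatisfiesJumpEquation t₀ t₁ a₀ α {p ∈ Pi ω | |p.2| ≤ n} (fun t => Zn t ω)) ∧
      ∀ Zn : ℕ → ℝ → Ω → ℝ,
        (∀ n : ℕ, ∀ᵐ ω ∂P, IsCadlagOn t₀ t₁ (fun t => Zn n t ω) ∧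
          SatisfiesJumpEquation t₀ t₁ a₀ α {p ∈ Pi ω | |p.2| ≤ n} (fun t => Zn n t ω)) →
        ∀ᵐ ω ∂P, Tendsto (fun n : ℕ => ⨆ t ∈ Ico t₀ t₁, ‖Zn n t ω - Z t ω‖ₑ) atTop (𝓝 0) := by
  obtain ⟨C, hC⟩ := hα'
  have hC0 : 0 ≤ C := (abs_nonneg _).trans (hC 0)
  have hF : IsMajorized (jumpSize α) (jumpBound a b C) :=
    isMajorized_jumpSize ha (hα.differentiable one_ne_zero) hC hαab
  have hKm := measurable_jumpBound a b C
  have hFm := measurable_jumpSize α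
  have hIoc : ∀ s t : ℝ, MeasurableSet (Ioc s t ×ˢ univ : Set (ℝ × ℝ)) := fun s t =>
    measurableSet_Ioc.prod MeasurableSet.univ
  have hyle : ∀ r : ℝ, MeasurableSet {q : ℝ × ℝ | |q.2| ≤ r} := fun r =>
    measurableSet_le (by fun_prop) measurable_const
  have hgood : ∀ᵐ ω ∂P, Summable ((Pi ω).indicator (jumpBound a b C)) :=
    hPi.ae_summable_indicator (hyle 1) (volume_strip_ne_top t₀ t₁) hKm hF.nonneg
      (lintegral_jumpBound_ne_top ha hab.le hb hC0 t₀ t₁)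
  have hadapted : ∀ t, Measurable[countSigma Pi (Ioc t₀ t ×ˢ univ)] fun ω =>
      setFlow Prod.fst (jumpSize α) (jumpBound a b C) (Pi ω ∩ Ioc t₀ t ×ˢ univ) a₀ := fun t =>
    measurable_setFlow hPi.countable (hIoc t₀ t) hF hKm hFm measurable_fst
      (fun q hq => Ioc_subset_Icc_self hq.1) a₀
  -- The filtration is not completed, so Z(t) is defined for every ω from the points in (t₀, t]
  -- alone; the default value for non-summable weights is decided by these points too.
  refine ⟨fun t ω => setFlow Prod.fst (jumpSize α) (jumpBound a b C)
    (Pi ω ∩ Ioc t₀ t ×ˢ univ) a₀, ⟨fun t => hadapted t, fun s t hst A hA => ?_⟩, ?_,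
    fun n => ?_, fun Zn hZn => ?_⟩
  · refine condExp_preimage_eq_of_indep (m' := countSigma Pi (Ioc (s : ℝ) t ×ˢ univ))
      (hPi.countSigma_le (Ioc t₀ s ×ˢ univ)) (hPi.countSigma_le _)
      (hPi.indep_countSigma (hIoc _ _) (hIoc _ _) ?_) (hadapted s)
      (measurable_uncurry_setFlow hPi.countable (hIoc s t) hF hKm hFm measurable_fst
        fun q hq => Ioc_subset_Icc_self hq.1) ?_ hA
    · exact Set.disjoint_left.2 fun q h h' => not_lt.2 h.1.2 h'.1.1
    · filter_upwards [hgood] with ω hω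
      exact setFlow_Ioc hF hω (hsub ω) hst
  · filter_upwards [hgood] with ω hω
    have h := setFlow_path (a₀ := a₀) hF hω (hsub ω)
    refine ⟨h.1, ?_, h.2⟩
    have h0 := h.2 t₀ ⟨le_rfl, ht⟩
    simp only [Ioc_self, indicator_empty, zero_mul] at h0
    simpa [sub_eq_zero] using h0.unique hasSum_zero
  · refine ⟨fun t ω => setFlow Prod.fst (jumpSize α) (jumpBound a b C)
      ((Pi ω ∩ {p | |p.2| ≤ n}) ∩ Ioc t₀ t ×ˢ univ) a₀, fun t _ => ?_, ?_⟩
    · simp only [inter_assoc]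
      exact (measurable_setFlow hPi.countable ((hyle n).inter (hIoc t₀ t)) hF hKm hFm
        measurable_fst (fun q hq => Ioc_subset_Icc_self hq.2.1) a₀).mono
        (hPi.countSigma_le _) le_rfl
    · filter_upwards [hgood] with ω hω
      exact setFlow_path hF (hω.indicator_subset inter_subset_left)
        (inter_subset_left.trans (hsub ω))
  · filter_upwards [hgood, ae_all_iff.2 hZn] with ω hω h
    exact tendsto_iSup_enorm_sub hF hω (hsub ω) fun n => (h n).2
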